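/- Let $F$ be the field with $2^7$ elements and let $\mathrm{PG}(2,2^7)$ be the projective plane over $F$. For $\alpha\in F$ with absolute trace $\mathrm{Tr}(\alpha)=1$ and $\lambda\in F^*$ let $F_{\alpha,1,\lambda}$ be the conic $\{(x,y,z):\alpha x^2+xy+y^2+\lambda z^2=0\}$; all these conics have nucleus $F_0=(0,0,1)$. A maximal arc of degree $4$ is a non-empty proper set of points that every line meets in $0$ or $4$ points. It is of Denniston type if an automorphism of the plane (an element of $\mathrm{P\Gamma L}(3,2^7)$) maps $\{F_0\}\cup\bigcup_{\lambda\in A}F_{\alpha,1,\lambda}$ onto it, for some $\alpha$ with $\mathrm{Tr}(\alpha)=1$ and some $A\subseteq F^*$ such that $A\cup\{0\}$ is closed under addition; call it then a Denniston $4$-arc. Two arcs are isomorphic if an automorphism of the plane maps one onto the other. Write $C_\lambda=F_{1,1,\lambda}$, that is, $C_\lambda:\ x^2+xy+y^2+\lambda z^2=0$, and call $\{C_\lambda:\lambda\in F^*\}$ the standard pencil. A conic $C$ is said to generate, together with $C_1$, the Denniston $4$-arc $K$ if $K$ is the unique Denniston $4$-arc containing $C_1\cup C$. Then there are exactly three isomorphism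 classes of Denniston $4$-arcs in $\mathrm{PG}(2,2^7)$, and for each of them there are exactly $42$ conics $C\neq C_1$ in the standard pencil that generate, together with $C_1$, a Denniston $4$-arc belonging to that class. Moreover, there are exactly $63$ Denniston $4$-arcs that contain $C_1$ and consist of conics of the standard pencil together with $F_0$, and exactly $21$ of them belong to each of the three isomorphism classes. -/

import Mathlib

open scoped LinearAlgebra.Projectivization

namespace PG2

/-- The points of the Desarguesian projective plane `PG(2, F)`. -/
abbrev Point (F : Type*) [Field F] : Type _ := ℙ F (Fin 3 → F)

/-- The point set of the line `[u, v, w]`: the points `(a, b, c)` with `au + bv + cw = 0`. -/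
def line {F : Type*} [Field F] [DecidableEq F] (l : ℙ F (Fin 3 → F)) : Set (Point F) :=
  {P | Projectivization.orthogonal P l}

/-- The quadratic form `α x² + x y + β y² + l z²`. -/
def conicForm {F : Type*} [Field F] (α β l : F) (v : Fin 3 → F) : F :=
  α * v 0 ^ 2 + v 0 * v 1 + β * v 1 ^ 2 + l * v 2 ^ 2

/-- The conic `F_{α,β,l}`: the set of points `(x, y, z)` with `α x² + x y + β y² + l z² = 0`. -/
def conic {F : Type*} [Field F] (α β l : F) : Set (Point F) :=
  {P | conicForm α β l P.rep = 0}

/-- Membership in a conic can be tested on any coordinate vector of the point. -/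
theorem mk_mem_conic {F : Type*} [Field F] (α β l : F) (v : Fin 3 → F) (hv : v ≠ 0) :
    Projectivization.mk F v hv ∈ conic α β l ↔ conicForm α β l v = 0 := by
  obtain ⟨a, ha⟩ := Projectivization.exists_smul_eq_mk_rep F v hv
  have h : conicForm α β l (Projectivization.mk F v hv).rep
      = (a : F) ^ 2 * conicForm α β l v := by
    rw [← ha]
    simp only [conicForm, Units.smul_def, Pi.smul_apply, smul_eq_mul]
    ring
  simp [conic, h]

/-- The point `F₀ = (0, 0, 1)`. -/
def nucleus (F : Type*) [Field F] : Point F :=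
  Projectivization.mk F ![0, 0, 1] (fun h => one_ne_zero (congrFun h 2))

/-- The standard pencil of conics `{F_{α,1,l} : l ≠ 0}`. -/
def standardPencil {F : Type*} [Field F] (α : F) : Set (Set (Point F)) :=
  {C | ∃ l : F, l ≠ 0 ∧ C = conic α 1 l}

/-- The union of the conics `F_{α,1,l}`, `l ∈ A`, together with their nucleus `F₀`. -/
def pencilUnion {F : Type*} [Field F] (α : F) (A : Set F) : Set (Point F) :=
  {nucleus F} ∪ ⋃ l ∈ A, conic α 1 l

/-- Two point sets are isomorphic if an automorphism of the plane, i.e. the map of points induced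
by a bijective semilinear map `x ↦ M x^σ` (an element of `PΓL(3, F)`), maps one onto the other. -/
def Isomorphic {F : Type*} [Field F] (K K' : Set (Point F)) : Prop :=
  ∃ (σ : F ≃+* F) (f : (Fin 3 → F) →ₛₗ[(σ : F →+* F)] (Fin 3 → F))
    (hf : Function.Bijective f), Projectivization.map f hf.injective '' K = K'

/-- A maximal arc of degree `d`: a non-empty proper set of points met by every line in
`0` or `d` points. -/
def IsMaximalArc {F : Type*} [Field F] [DecidableEq F] (d : ℕ) (K : Set (Point F)) : Prop :=
  K.Nonempty ∧ K ≠ Set.univ ∧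
    ∀ l : ℙ F (Fin 3 → F), (K ∩ line l).ncard = 0 ∨ (K ∩ line l).ncard = d

/-- Point sets of Denniston type: those isomorphic to the union of `F₀` and the conics
`F_{α,1,l}`, `l ∈ A`, where `α` has absolute trace `1` and `A` is a set of non-zero elements such
that `A ∪ {0}` is closed under addition. -/
def IsDennistonType {F : Type*} [Field F] [Algebra (ZMod 2) F] (K : Set (Point F)) : Prop :=
  ∃ (α : F) (A : Set F), Algebra.trace (ZMod 2) F α = 1 ∧ (0 : F) ∉ A ∧
    (∀ a ∈ A ∪ {0}, ∀ b ∈ A ∪ {0}, a + b ∈ A ∪ {0}) ∧ Isomorphic (pencilUnion α A) K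

/-- Maximal arcs of degree `4` of Denniston type. -/
def IsDenniston4Arc {F : Type*} [Field F] [DecidableEq F] [Algebra (ZMod 2) F]
    (K : Set (Point F)) : Prop :=
  IsMaximalArc 4 K ∧ IsDennistonType K

/-- `C` and `C'` generate `K`: `K` is the unique degree `4` maximal arc of Denniston type
containing `C ∪ C'`. -/
def Generates {F : Type*} [Field F] [DecidableEq F] [Algebra (ZMod 2) F]
    (C C' K : Set (Point F)) : Prop :=
  (IsDenniston4Arc K ∧ C ∪ C' ⊆ K) ∧
    ∀ K' : Set (Point F), IsDenniston4Arc K' → C ∪ C' ⊆ K' → K' = K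

/-- The isomorphism classes of degree `4` maximal arcs of Denniston type in `PG(2, F)`. -/
def denniston4Classes (F : Type*) [Field F] [DecidableEq F] [Algebra (ZMod 2) F] :
    Set (Set (Set (Point F))) :=
  {T | ∃ D : Set (Point F), IsDenniston4Arc D ∧ T = {K | Isomorphic D K}}

/-- The degree `4` maximal arcs of Denniston type that contain the conic `F_{α,1,1}` and consist
of conics of the standard pencil together with the nucleus. -/
def denniston4ArcsInPencil {F : Type*} [Field F] [DecidableEq F] [Algebra (ZMod 2) F] (α : F) :
    Set (Set (Point F)) :=
  {K | IsDenniston4Arc K ∧ conic α 1 1 ⊆ K ∧ ∃ A : Set F, (0 : F) ∉ A ∧ K = pencilUnion α A}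

end PG2

/-! Let N(x,y) = x² + xy + y². It is anisotropic because F has no primitive cube root of unity, so a
union of conics of the standard pencil with its nucleus is the set of points where N/z² takes a
value in A ∪ {0}; the nucleus is the value 0. A shear reduces every α of trace 1 to α = 1. Each
additive group A ∪ {0} of order 4 gives a maximal arc (`isMaximalArc_pencilUnion`), and scaling z
puts 1 into A. So every Denniston 4-arc is isomorphic to some `arc b` with b ≠ 0, 1. There are 126
such b, and only b and 1 + b give the same arc: this is the count 63.

The crux is rigidity (`eq_pencilUnion_of_isomorphic`): an isomorphic copy of such an arc that
contains C₁ and another conic of the pencil is again a pencil union, with parameter set cσ(A).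
Indeed one of the at most four pulled-back forms shares more than four points with the given conic,
hence is proportional to its form; doing this for two conics forces the map to preserve N and z² up
to scalars. Hence C₁ and C_b generate exactly `arc b`, and `arc b`, `arc c` are isomorphic exactly
when the groups {0,1,b,1+b} and {0,1,c,1+c} agree up to scaling and a field automorphism.

Renormalising a scaled group so that it contains 1 is the action of S₃ on b, with invariant `jInv`,
and the automorphisms are the powers of Frobenius. So isomorphism means that the invariants are
Frobenius conjugates (`isomorphic_arc_iff`). The fibres of `jInv` have 6 elements, and its values
avoid 0 and 1, so each has 7 conjugates. Each class has 42 parameters: 126/42 = 3 classes, with 42/2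
= 21 arcs through C₁ in each. -/

namespace PG2

/-! ### Point sets as cones of vectors, and semilinear isomorphisms -/

variable {F : Type*} [Field F]

/-- The non-zero vectors spanning a point of `K`. -/
def cone (K : Set (Point F)) : Set (Fin 3 → F) :=
  {v | ∃ hv : v ≠ 0, Projectivization.mk F v hv ∈ K}

theorem cone_injective : Function.Injective (cone : Set (Point F) → _) := by
  have key : ∀ K K' : Set (Point F), cone K = cone K' → K ⊆ K' := by
    intro K K' h P hP
    have : P.rep ∈ cone K := ⟨P.rep_nonzero, by simpa using hP⟩
    rw [h] at this
    obtain ⟨_, h'⟩ := this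
    simpa using h'
  exact fun K K' h => (key K K' h).antisymm (key K' K h.symm)

theorem mk_mem_iff (K : Set (Point F)) (v : Fin 3 → F) (hv : v ≠ 0) :
    Projectivization.mk F v hv ∈ K ↔ v ∈ cone K :=
  ⟨fun h => ⟨hv, h⟩, fun h => h.2⟩

/-- Together with `Isomorphic.exists_map`, this replaces projective maps by maps of vectors, so that
equations can be tested without choosing representatives. -/
theorem isomorphic_of_map {K K' : Set (Point F)} (σ : F ≃+* F) (f : (Fin 3 → F) → (Fin 3 → F))
    (hadd : ∀ x y, f (x + y) = f x + f y) (hsmul : ∀ (c : F) x, f (c • x) = σ c • f x)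
    (hf : Function.Bijective f) (h : ∀ v, v ∈ cone K ↔ f v ∈ cone K') : Isomorphic K K' := by
  let g : (Fin 3 → F) →ₛₗ[(σ : F →+* F)] (Fin 3 → F) :=
    { toFun := f, map_add' := hadd, map_smul' := hsmul }
  refine ⟨σ, g, hf, ?_⟩
  ext P
  constructor
  · rintro ⟨R, hR, rfl⟩
    induction R using Projectivization.ind with
    | h v hv =>
      rw [Projectivization.map_mk, mk_mem_iff]
      exact (h v).1 ⟨hv, hR⟩
  · intro hP
    induction P using Projectivization.ind with
    | h w hw =>
      obtain ⟨v, rfl⟩ := hf.2 w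
      have hv : v ∈ cone K := (h v).2 ⟨hw, hP⟩
      exact ⟨_, hv.2, by rw [Projectivization.map_mk]; rfl⟩

theorem Isomorphic.exists_map {K K' : Set (Point F)} (h : Isomorphic K K') :
    ∃ (σ : F ≃+* F) (f : (Fin 3 → F) → (Fin 3 → F)),
      (∀ x y, f (x + y) = f x + f y) ∧ (∀ (c : F) x, f (c • x) = σ c • f x) ∧
      Function.Bijective f ∧ ∀ v, v ∈ cone K ↔ f v ∈ cone K' := by
  obtain ⟨σ, f, hf, rfl⟩ := h
  have := RingHomInvPair.of_ringEquiv σ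
  refine ⟨σ, f, map_add f, fun c x => map_smulₛₗ f c x, hf, fun v => ?_⟩
  have hz : f v ≠ 0 ↔ v ≠ 0 := by rw [Ne, Ne, map_eq_zero_iff f hf.1]
  constructor
  · rintro ⟨hv, hK⟩
    exact ⟨hz.2 hv, _, hK, Projectivization.map_mk _ _ _ _⟩
  · rintro ⟨hv, R, hR, hK⟩
    have hv' := hz.1 hv
    rw [← Projectivization.map_mk f hf.1 v hv'] at hK
    have := Projectivization.map_injective (τ := (σ.symm : F →+* F)) f hf.1 hK
    exact ⟨hv', this ▸ hR⟩

theorem Isomorphic.refl (K : Set (Point F)) : Isomorphic K K :=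
  isomorphic_of_map (RingEquiv.refl F) id (fun _ _ => rfl) (fun _ _ => rfl) Function.bijective_id
    fun _ => Iff.rfl

theorem Isomorphic.trans {K K' K'' : Set (Point F)} (h : Isomorphic K K')
    (h' : Isomorphic K' K'') : Isomorphic K K'' := by
  obtain ⟨σ, f, fa, fs, fb, fc⟩ := h.exists_map
  obtain ⟨τ, g, ga, gs, gb, gc⟩ := h'.exists_map
  exact isomorphic_of_map (σ.trans τ) (g ∘ f) (fun x y => by simp [fa, ga])
    (fun c x => by simp [fs, gs]) (gb.comp fb) fun v => (fc v).trans (gc _)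

theorem Isomorphic.symm {K K' : Set (Point F)} (h : Isomorphic K K') : Isomorphic K' K := by
  obtain ⟨σ, f, fa, fs, fb, fc⟩ := h.exists_map
  let e := Equiv.ofBijective f fb
  have he : ∀ v, f (e.symm v) = v := e.apply_symm_apply
  refine isomorphic_of_map σ.symm e.symm (fun x y => fb.1 ?_) (fun c x => fb.1 ?_)
    e.symm.bijective fun v => ?_
  · rw [fa, he, he, he]
  · rw [fs, he, he, RingEquiv.apply_symm_apply]
  · rw [fc, he]

theorem mem_cone_pencilUnion (α : F) (A : Set F) (v : Fin 3 → F) :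
    v ∈ cone (pencilUnion α A) ↔
      v ≠ 0 ∧ ((v 0 = 0 ∧ v 1 = 0) ∨ ∃ l ∈ A, conicForm α 1 l v = 0) := by
  have hn : ∀ hv : v ≠ 0, Projectivization.mk F v hv = nucleus F ↔ v 0 = 0 ∧ v 1 = 0 := by
    intro hv
    rw [nucleus, Projectivization.mk_eq_mk_iff']
    constructor
    · rintro ⟨a, rfl⟩
      simp
    · rintro ⟨h0, h1⟩
      exact ⟨v 2, by ext i; fin_cases i <;> simp [h0, h1]⟩
  constructor
  · rintro ⟨hv, h⟩
    refine ⟨hv, ?_⟩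
    rcases h with h | h
    · exact Or.inl ((hn hv).1 h)
    · simp only [Set.mem_iUnion, mk_mem_conic] at h
      obtain ⟨l, hl, h⟩ := h
      exact Or.inr ⟨l, hl, h⟩
  · rintro ⟨hv, h⟩
    refine ⟨hv, ?_⟩
    rcases h with h | ⟨l, hl, h⟩
    · exact Or.inl ((hn hv).2 h)
    · refine Or.inr ?_
      simp only [Set.mem_iUnion, mk_mem_conic]
      exact ⟨l, hl, h⟩

theorem mem_cone_conic (α β l : F) (v : Fin 3 → F) :
    v ∈ cone (conic α β l) ↔ v ≠ 0 ∧ conicForm α β l v = 0 := by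
  constructor
  · rintro ⟨hv, h⟩
    exact ⟨hv, (mk_mem_conic _ _ _ _ _).1 h⟩
  · rintro ⟨hv, h⟩
    exact ⟨hv, (mk_mem_conic _ _ _ _ _).2 h⟩

theorem cone_mono {K K' : Set (Point F)} (h : K ⊆ K') : cone K ⊆ cone K' :=
  fun _ hv => ⟨hv.1, h hv.2⟩

section Transport

variable [DecidableEq F]

theorem mk_mem_line_mk (v w : Fin 3 → F) (hv : v ≠ 0) (hw : w ≠ 0) :
    Projectivization.mk F v hv ∈ line (Projectivization.mk F w hw) ↔ dotProduct v w = 0 :=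
  Projectivization.orthogonal_mk hv hw

theorem IsMaximalArc.of_isomorphic {d : ℕ} {K K' : Set (Point F)} (hK : IsMaximalArc d K')
    (h : Isomorphic K K') : IsMaximalArc d K := by
  obtain ⟨σ, f, hf, rfl⟩ := h
  have := RingHomInvPair.of_ringEquiv σ
  obtain ⟨h1, h2, h3⟩ := hK
  have hinj := Projectivization.map_injective (τ := (σ.symm : F →+* F)) f hf.1
  have hsurj : Function.Surjective (Projectivization.map f hf.1) := by
    intro P
    induction P using Projectivization.ind with
    | h w hw =>
      obtain ⟨v, rfl⟩ := hf.2 w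
      have hv : v ≠ 0 := by rintro rfl; exact hw (map_zero f)
      exact ⟨Projectivization.mk F v hv, Projectivization.map_mk _ _ _ _⟩
  refine ⟨h1.of_image, ?_, fun l => ?_⟩
  · rintro rfl
    exact h2 (Set.image_univ_of_surjective hsurj)
  · induction l using Projectivization.ind with
    | h w hw =>
      let e := Equiv.ofBijective f hf
      have he : ∀ v, e.symm (f v) = v := e.symm_apply_apply
      have he' : ∀ v, f (e.symm v) = v := e.apply_symm_apply
      have hadd : ∀ x y, e.symm (x + y) = e.symm x + e.symm y := fun x y =>
        hf.1 (by rw [map_add f, he', he', he'])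
      have hsmul : ∀ (c : F) x, e.symm (c • x) = σ.symm c • e.symm x := fun c x =>
        hf.1 (by rw [map_smulₛₗ f, he', he']; simp)
      -- The image line is the kernel of φ: applying σ undoes the twist of the inverse map, so φ is
      -- linear and has a coordinate vector w'.
      let φ : (Fin 3 → F) →ₗ[F] F :=
        { toFun := fun v => σ (dotProduct (e.symm v) w)
          map_add' := fun x y => by simp [hadd]
          map_smul' := fun c x => by simp [hsmul] }
      let w' : Fin 3 → F := fun i => φ (Pi.single i 1)
      have hφ : ∀ v, dotProduct v w' = φ v := by
        intro v
        rw [LinearMap.pi_apply_eq_sum_univ φ v]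
        simp only [dotProduct, w', smul_eq_mul]
        refine Finset.sum_congr rfl fun i _ => ?_
        congr 2
        ext j
        simp [Pi.single_apply, eq_comm]
      have hφf : ∀ v, φ (f v) = σ (dotProduct v w) := fun v => by
        change σ (dotProduct (e.symm (f v)) w) = _
        rw [he]
      have hw' : w' ≠ 0 := by
        intro h0
        apply hw
        ext i
        have := hφ (f (Pi.single i 1))
        rw [h0, hφf] at this
        simpa using this.symm
      have := h3 (Projectivization.mk F w' hw')
      have himg : Projectivization.map f hf.1 '' (K ∩ line (Projectivization.mk F w hw)) =
          Projectivization.map f hf.1 '' K ∩ line (Projectivization.mk F w' hw') := by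
        rw [Set.image_inter hinj]
        ext P
        refine and_congr_right fun _ => ?_
        obtain ⟨R, rfl⟩ := hsurj P
        rw [hinj.mem_set_image]
        induction R using Projectivization.ind with
        | h v hv =>
          rw [Projectivization.map_mk, mk_mem_line_mk, mk_mem_line_mk, hφ, hφf]
          simp
      rwa [← himg, Set.ncard_image_of_injective _ hinj] at this

end Transport

/-! ### The standard pencil over the field of order 128 -/

/-- The quadratic form `x² + x y + y²`. -/
def normForm {F : Type*} [Field F] (x y : F) : F := x ^ 2 + x * y + y ^ 2

section Field128

variable {F : Type*} [Field F]

theorem pow_card_128 (hF : Nat.card F = 2 ^ 7) (x : F) : x ^ 128 = x := by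
  have : Finite F := Nat.finite_of_card_ne_zero (by rw [hF]; norm_num)
  have := Fintype.ofFinite F
  have h := FiniteField.pow_card x
  rwa [Fintype.card_eq_nat_card, hF] at h

theorem exists_sq_eq (hF : Nat.card F = 2 ^ 7) (l : F) : ∃ m, m ^ 2 = l :=
  ⟨l ^ 64, by rw [← pow_mul]; exact pow_card_128 hF l⟩

theorem vec_ne_zero_of_last {v : Fin 3 → F} (h : v 2 ≠ 0) : v ≠ 0 := by
  rintro rfl
  exact h rfl

theorem conic_subset_pencilUnion {l : F} {A : Set F} (h : l ∈ A) (α : F) :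
    conic α 1 l ⊆ pencilUnion α A :=
  fun _ hP => Or.inr (Set.mem_biUnion h hP)

variable [CharP F 2]

theorem sq_injective {x y : F} (h : x ^ 2 = y ^ 2) : x = y := by
  have : (x + y) ^ 2 = 0 := by grind
  have := pow_eq_zero_iff (two_ne_zero) |>.1 this
  grind

theorem sq_add_self_add_one_ne_zero (hF : Nat.card F = 2 ^ 7) (t : F) :
    t ^ 2 + t + 1 ≠ 0 := by
  intro h
  have h3 : t ^ 3 = 1 := by linear_combination (t - 1) * h
  -- A root would be a cube root of unity; as 3 does not divide 127, this collapses to t = t².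
  have h2 : t ^ 128 = t ^ 2 := by
    rw [show 128 = 3 * 42 + 2 from rfl, pow_add, pow_mul, h3, one_pow, one_mul]
  rw [pow_card_128 hF] at h2
  grind

theorem normForm_eq_zero (hF : Nat.card F = 2 ^ 7) {x y : F} (h : normForm x y = 0) :
    x = 0 ∧ y = 0 := by
  unfold normForm at h
  by_cases hy : y = 0
  · subst hy
    simpa using h
  · exfalso
    refine sq_add_self_add_one_ne_zero hF (x / y) ?_
    field_simp
    linear_combination h

/-- Anisotropy of the norm form lets the nucleus be treated as the conic with parameter 0, so that
the whole additive group `insert 0 A` appears. -/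
theorem mem_cone_pencilUnion_one (hF : Nat.card F = 2 ^ 7) (A : Set F) (v : Fin 3 → F) :
    v ∈ cone (pencilUnion 1 A) ↔
      v ≠ 0 ∧ ∃ h ∈ insert 0 A, normForm (v 0) (v 1) = h * v 2 ^ 2 := by
  rw [mem_cone_pencilUnion]
  refine and_congr_right fun _ => ?_
  have key : ∀ l, conicForm 1 1 l v = 0 ↔ normForm (v 0) (v 1) = l * v 2 ^ 2 := by
    intro l
    unfold conicForm normForm
    constructor <;> intro h <;> grind
  simp only [Set.exists_mem_insert, zero_mul, key]
  refine or_congr ⟨fun h => by simp [h, normForm], fun h => normForm_eq_zero hF h⟩ Iff.rfl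

theorem mem_cone_conic_one (l : F) (v : Fin 3 → F) :
    v ∈ cone (conic 1 1 l) ↔ v ≠ 0 ∧ normForm (v 0) (v 1) = l * v 2 ^ 2 := by
  rw [mem_cone_conic]
  refine and_congr_right fun _ => ?_
  unfold conicForm normForm
  constructor <;> intro h <;> grind

/-- The single point (0, m, 1) with m² = l already detects the parameter l. -/
theorem mem_of_conic_subset (hF : Nat.card F = 2 ^ 7) {l : F} {A : Set F}
    (h : conic 1 1 l ⊆ pencilUnion 1 A) : l ∈ insert 0 A := by
  obtain ⟨m, rfl⟩ := exists_sq_eq hF l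
  have hm : ![0, m, 1] ∈ cone (conic 1 1 (m ^ 2)) :=
    (mem_cone_conic_one _ _).2 ⟨vec_ne_zero_of_last (by simp), by simp [normForm]⟩
  obtain ⟨_, k, hk, he⟩ := (mem_cone_pencilUnion_one hF _ _).1 (cone_mono h hm)
  simp [normForm] at he
  rwa [he]

theorem conic_injective (hF : Nat.card F = 2 ^ 7) {l k : F}
    (hl : l ≠ 0) (h : conic 1 1 l = conic 1 1 k) : l = k := by
  have := mem_of_conic_subset hF (h ▸ conic_subset_pencilUnion (Set.mem_singleton k) 1 :
    conic 1 1 l ⊆ pencilUnion 1 {k})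
  simpa [hl] using this

theorem pencilUnion_subset (hF : Nat.card F = 2 ^ 7) {A B : Set F} (hA : (0 : F) ∉ A)
    (h : pencilUnion 1 A ⊆ pencilUnion 1 B) : A ⊆ B := by
  intro l hl
  have := mem_of_conic_subset hF ((conic_subset_pencilUnion hl 1).trans h)
  rcases this with rfl | this
  · exact (hA hl).elim
  · exact this

theorem pencilUnion_injective (hF : Nat.card F = 2 ^ 7) {A B : Set F} (hA : (0 : F) ∉ A)
    (hB : (0 : F) ∉ B) (h : pencilUnion 1 A = pencilUnion 1 B) : A = B :=
  (pencilUnion_subset hF hA h.subset).antisymm (pencilUnion_subset hF hB h.superset)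

/-- Semilinear scalings of the last coordinate act on the unions of conics of the pencil. -/
theorem isomorphic_pencilUnion (hF : Nat.card F = 2 ^ 7) (σ : F ≃+* F) {c : F} (hc : c ≠ 0)
    {A B : Set F} (h : ∀ x, x ∈ insert 0 A ↔ c * σ x ∈ insert 0 B) :
    Isomorphic (pencilUnion 1 A) (pencilUnion 1 B) := by
  -- Multiplying z by s divides N/z² by s² = c⁻¹, that is, multiplies it by c.
  obtain ⟨s, hs⟩ := exists_sq_eq hF c⁻¹
  have hs0 : s ≠ 0 := by rintro rfl; simp [hc.symm] at hs
  refine isomorphic_of_map σ (fun v => ![σ (v 0), σ (v 1), s * σ (v 2)]) ?_ ?_ ⟨?_, ?_⟩ ?_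
  · intro x y
    ext i
    fin_cases i <;> simp [mul_add]
  · intro x y
    ext i
    fin_cases i <;> simp [mul_left_comm]
  · intro x y hxy
    ext i
    have := congrFun hxy i
    fin_cases i <;> simpa [hs0] using this
  · intro w
    refine ⟨![σ.symm (w 0), σ.symm (w 1), σ.symm (w 2 / s)], ?_⟩
    ext i
    fin_cases i <;> simp
    field_simp
  · intro v
    rw [mem_cone_pencilUnion_one hF, mem_cone_pencilUnion_one hF]
    refine and_congr ?_ ?_
    · refine not_congr ⟨fun hv => ?_, fun hv => ?_⟩
      · subst hv
        ext i
        fin_cases i <;> simp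
      · ext i
        have := congrFun hv i
        fin_cases i <;> simpa [hs0] using this
    · have hn : normForm (σ (v 0)) (σ (v 1)) = σ (normForm (v 0) (v 1)) := by simp [normForm]
      simp only [Matrix.cons_val_zero, Matrix.cons_val_one, Matrix.cons_val_two, hn]
      have key : ∀ x, normForm (v 0) (v 1) = x * v 2 ^ 2 ↔
          σ (normForm (v 0) (v 1)) = c * σ x * (s * σ (v 2)) ^ 2 := by
        intro x
        rw [← σ.injective.eq_iff, mul_pow, hs, map_mul, map_pow]
        have : c * σ x * (c⁻¹ * σ (v 2) ^ 2) = σ x * σ (v 2) ^ 2 := by field_simp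
        rw [this]
      constructor
      · rintro ⟨x, hx, hxe⟩
        exact ⟨_, (h x).1 hx, (key x).1 hxe⟩
      · rintro ⟨y, hy, hye⟩
        have hcy : c * σ (σ.symm (y / c)) = y := by
          rw [RingEquiv.apply_symm_apply]
          field_simp
        exact ⟨σ.symm (y / c), (h _).2 (by rwa [hcy]), (key _).2 (by rw [hcy]; exact hye)⟩

/-- The shear `y ↦ y + t x` identifies the pencils with parameters `1 + t + t²` and `1`. -/
theorem isomorphic_pencilUnion_shear (t : F) (A : Set F) :
    Isomorphic (pencilUnion (1 + t + t ^ 2) A) (pencilUnion 1 A) := by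
  refine isomorphic_of_map (RingEquiv.refl F) (fun v => ![v 0, v 1 + t * v 0, v 2]) ?_ ?_
    ⟨?_, ?_⟩ ?_
  · intro x y
    ext i
    fin_cases i <;> simp
    ring
  · intro x y
    ext i
    fin_cases i <;> simp
    ring
  · intro x y hxy
    have h0 := congrFun hxy 0
    have h1 := congrFun hxy 1
    have h2 := congrFun hxy 2
    simp at h0 h1 h2
    ext i
    fin_cases i <;> simp_all
  · intro w
    refine ⟨![w 0, w 1 - t * w 0, w 2], ?_⟩
    ext i
    fin_cases i <;> simp
  · intro v
    rw [mem_cone_pencilUnion, mem_cone_pencilUnion]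
    refine and_congr (not_congr ⟨fun hv => ?_, fun hv => ?_⟩) (or_congr ?_ ?_)
    · subst hv
      ext i
      fin_cases i <;> simp
    · have h0 := congrFun hv 0
      have h1 := congrFun hv 1
      have h2 := congrFun hv 2
      simp at h0 h1 h2
      ext i
      fin_cases i <;> simp_all
    · simp only [Matrix.cons_val_zero, Matrix.cons_val_one]
      exact and_congr_right fun h0 => by simp [h0]
    · refine exists_congr fun l => and_congr_right fun _ => ?_
      simp only [conicForm, Matrix.cons_val_zero, Matrix.cons_val_one, Matrix.cons_val_two]
      constructor <;> intro h <;> simp at h ⊢ <;> grind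

end Field128

/-! ### The absolute trace and the equation t² + t = x -/

section Trace

variable {F : Type*} [Field F] [Algebra (ZMod 2) F]

theorem charP_two : CharP F 2 :=
  charP_of_injective_algebraMap (algebraMap (ZMod 2) F).injective 2

theorem finrank_eq_seven (hF : Nat.card F = 2 ^ 7) : Module.finrank (ZMod 2) F = 7 := by
  have : Finite F := Nat.finite_of_card_ne_zero (by rw [hF]; norm_num)
  have h := Module.natCard_eq_pow_finrank (K := ZMod 2) (V := F)
  rw [hF, Nat.card_zmod] at h
  exact (Nat.pow_right_injective le_rfl h).symm

theorem trace_eq_sum (hF : Nat.card F = 2 ^ 7) (x : F) :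
    algebraMap (ZMod 2) F (Algebra.trace (ZMod 2) F x) =
      x + x ^ 2 + x ^ 4 + x ^ 8 + x ^ 16 + x ^ 32 + x ^ 64 := by
  have : Finite F := Nat.finite_of_card_ne_zero (by rw [hF]; norm_num)
  rw [FiniteField.algebraMap_trace_eq_sum_pow, finrank_eq_seven hF]
  simp [Finset.sum_range_succ]

theorem trace_one (hF : Nat.card F = 2 ^ 7) : Algebra.trace (ZMod 2) F 1 = 1 := by
  have := charP_two (F := F)
  apply (algebraMap (ZMod 2) F).injective
  rw [trace_eq_sum hF, map_one]
  grind

theorem trace_sq_add (hF : Nat.card F = 2 ^ 7) (t : F) :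
    Algebra.trace (ZMod 2) F (t ^ 2 + t) = 0 := by
  have := charP_two (F := F)
  apply (algebraMap (ZMod 2) F).injective
  rw [map_add, map_add, trace_eq_sum hF, trace_eq_sum hF, map_zero]
  have := pow_card_128 hF t
  grind

/-- Elements of trace zero are of the form `t² + t`; the half-trace is a solution. -/
theorem exists_sq_add_eq (hF : Nat.card F = 2 ^ 7) {x : F}
    (hx : Algebra.trace (ZMod 2) F x = 0) : ∃ t : F, t ^ 2 + t = x := by
  have := charP_two (F := F)
  have h := trace_eq_sum hF x
  rw [hx, map_zero] at h
  refine ⟨x + x ^ 4 + x ^ 16 + x ^ 64, ?_⟩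
  have := pow_card_128 hF x
  grind

theorem exists_isomorphic_pencilUnion_one (hF : Nat.card F = 2 ^ 7) {α : F}
    (hα : Algebra.trace (ZMod 2) F α = 1) (A : Set F) :
    Isomorphic (pencilUnion α A) (pencilUnion 1 A) := by
  have := charP_two (F := F)
  obtain ⟨t, ht⟩ := exists_sq_add_eq hF (x := α + 1) (by
    rw [map_add, hα, trace_one hF]; rfl)
  have : α = 1 + t + t ^ 2 := by grind
  rw [this]
  exact isomorphic_pencilUnion_shear t A

end Trace

/-! ### Intersections with lines; the maximal arc property -/

variable {F : Type*} [Field F] [DecidableEq F]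

/-- A line other than `z = 0` meets a union of conics of the pencil in affine
points which are counted by the values of a quadratic polynomial. -/
theorem ncard_pencilUnion_inter_line [CharP F 2] (hF : Nat.card F = 2 ^ 7) (A : Set F)
    (w : Fin 3 → F) (hw : w ≠ 0) (hw01 : ¬(w 0 = 0 ∧ w 1 = 0)) (p : Fin 2 → F)
    (hp : w 0 * p 0 + w 1 * p 1 = w 2) :
    (pencilUnion 1 A ∩ line (Projectivization.mk F w hw)).ncard =
      {t : F | normForm (p 0) (p 1) + w 2 * t + normForm (w 1) (w 0) * t ^ 2 ∈
        insert 0 A}.ncard := by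
  -- In characteristic 2 the direction of the affine line is (w 1, w 0). Its polar pairing with p is
  -- w 0 * p 0 + w 1 * p 1 = w 2, the linear coefficient in `hval`.
  have hne : ∀ t, ![p 0 + t * w 1, p 1 + t * w 0, 1] ≠ 0 :=
    fun t => vec_ne_zero_of_last (by simp)
  have hval : ∀ t, normForm (p 0 + t * w 1) (p 1 + t * w 0) =
      normForm (p 0) (p 1) + w 2 * t + normForm (w 1) (w 0) * t ^ 2 := by
    intro t
    unfold normForm
    grind
  have hinj : Function.Injective fun t => Projectivization.mk F _ (hne t) := by
    intro t s hts
    obtain ⟨a, ha⟩ := (Projectivization.mk_eq_mk_iff' F _ _ _ _).1 hts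
    have h0 := congrFun ha 0
    have h1 := congrFun ha 1
    have h2 := congrFun ha 2
    simp at h0 h1 h2
    subst h2
    simp at h0 h1
    rcases h0 with h0 | h0
    · exact h0.symm
    rcases h1 with h1 | h1
    · exact h1.symm
    exact (hw01 ⟨h1, h0⟩).elim
  rw [← Set.ncard_image_of_injective _ hinj]
  congr 1
  ext P
  constructor
  · rintro ⟨hP, hl⟩
    induction P using Projectivization.ind with
    | h v hv =>
      rw [mk_mem_iff, mem_cone_pencilUnion_one hF] at hP
      rw [mk_mem_line_mk, dotProduct, Fin.sum_univ_three] at hl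
      obtain ⟨_, k, hk, he⟩ := hP
      have hv2 : v 2 ≠ 0 := by
        intro h2
        have := normForm_eq_zero hF (by simpa [h2] using he)
        apply hv
        ext i
        fin_cases i <;> simp [this, h2]
      obtain ⟨t, ht0, ht1⟩ : ∃ t, v 0 / v 2 = p 0 + t * w 1 ∧ v 1 / v 2 = p 1 + t * w 0 := by
        by_cases h1 : w 1 = 0
        · have h0 : w 0 ≠ 0 := fun h0 => hw01 ⟨h0, h1⟩
          refine ⟨(v 1 / v 2 - p 1) / w 0, ?_, by field_simp; ring⟩
          rw [h1] at hl hp ⊢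
          apply mul_left_cancel₀ h0
          field_simp
          grind
        · refine ⟨(v 0 / v 2 - p 0) / w 1, by field_simp; ring, ?_⟩
          apply mul_left_cancel₀ h1
          field_simp
          grind
      refine ⟨t, ?_, ?_⟩
      · rw [Set.mem_ofPred_eq, ← hval, ← ht0, ← ht1]
        convert hk using 1
        unfold normForm at he ⊢
        field_simp
        linear_combination he
      · rw [Projectivization.mk_eq_mk_iff']
        refine ⟨(v 2)⁻¹, ?_⟩
        rw [← ht0, ← ht1]
        ext i
        fin_cases i <;> simp [hv2, div_eq_inv_mul]
  · rintro ⟨t, ht, rfl⟩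
    refine ⟨?_, ?_⟩
    · rw [mk_mem_iff, mem_cone_pencilUnion_one hF]
      exact ⟨hne t, _, ht, by simp [hval]⟩
    · rw [mk_mem_line_mk, dotProduct, Fin.sum_univ_three]
      simp
      grind

theorem pencilUnion_inter_line_infinity [CharP F 2] (hF : Nat.card F = 2 ^ 7) (A : Set F)
    (w : Fin 3 → F) (hw : w ≠ 0) (h0 : w 0 = 0) (h1 : w 1 = 0) :
    pencilUnion 1 A ∩ line (Projectivization.mk F w hw) = ∅ := by
  ext P
  simp only [Set.mem_inter_iff, Set.mem_empty_iff_false, iff_false, not_and]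
  intro hP hl
  induction P using Projectivization.ind with
  | h v hv =>
    rw [mk_mem_iff, mem_cone_pencilUnion_one hF] at hP
    rw [mk_mem_line_mk, dotProduct, Fin.sum_univ_three] at hl
    obtain ⟨_, k, hk, he⟩ := hP
    have hw2 : w 2 ≠ 0 := by
      intro h2
      apply hw
      ext i
      fin_cases i <;> simp [h0, h1, h2]
    have hv2 : v 2 = 0 := by simpa [h0, h1, hw2] using hl
    have := normForm_eq_zero hF (by simpa [hv2] using he)
    apply hv
    ext i
    fin_cases i <;> simp [this, hv2]

/-- The line x = 0 passes through the nucleus, and on it N/z² becomes t², a bijection of F; so it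
meets the set once for each element of `insert 0 A`. -/
theorem ncard_of_isMaximalArc [CharP F 2] (hF : Nat.card F = 2 ^ 7) {A : Set F} {d : ℕ}
    (hd : IsMaximalArc d (pencilUnion (1 : F) A)) : (insert 0 A).ncard = d := by
  have : Finite F := Nat.finite_of_card_ne_zero (by rw [hF]; norm_num)
  have hw : (![1, 0, 0] : Fin 3 → F) ≠ 0 := fun h => one_ne_zero (congrFun h 0)
  have h := ncard_pencilUnion_inter_line hF A ![1, 0, 0] hw (by simp) ![0, 0] (by simp)
  have hinj : Function.Injective fun t : F => t ^ 2 := fun _ _ => sq_injective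
  have hS : (insert 0 A).ncard = {t : F | t ^ 2 ∈ insert 0 A}.ncard := by
    rw [← Set.ncard_image_of_injective {t : F | t ^ 2 ∈ insert 0 A} hinj]
    congr 1
    ext x
    constructor
    · intro hx
      obtain ⟨m, rfl⟩ := exists_sq_eq hF x
      exact ⟨m, hx, rfl⟩
    · rintro ⟨m, hm, rfl⟩
      exact hm
  have h' : (pencilUnion 1 A ∩ line (Projectivization.mk F _ hw)).ncard = (insert 0 A).ncard := by
    rw [h, hS]
    congr 1
    ext t
    simp [normForm]
  rw [← h']
  refine (hd.2.2 _).resolve_left fun h0 => ?_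
  rw [h', Set.ncard_eq_zero] at h0
  exact (Set.insert_nonempty _ _).ne_empty h0

omit [DecidableEq F] in
-- The substitution t = (w/e)s turns the quadratic equation into s² + s = (h + q)e/w², solvable
-- exactly when the right side has trace 0; the two roots s then differ by 1.
theorem ncard_fibre [Algebra (ZMod 2) F] (hF : Nat.card F = 2 ^ 7) {q w e h : F} (hw : w ≠ 0)
    (he : e ≠ 0) :
    (Algebra.trace (ZMod 2) F ((h + q) * e / w ^ 2) = 0 →
      {t : F | q + w * t + e * t ^ 2 = h}.ncard = 2) ∧
    (Algebra.trace (ZMod 2) F ((h + q) * e / w ^ 2) ≠ 0 →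
      ∀ t, q + w * t + e * t ^ 2 ≠ h) := by
  have := charP_two (F := F)
  constructor
  · intro htr
    obtain ⟨s, hs⟩ := exists_sq_add_eq hF htr
    have hs' : e * ((w / e * s) ^ 2 * e + w * (w / e * s) + (h + q)) = 0 := by
      field_simp at hs ⊢
      grind
    have hs' := (mul_eq_zero.1 hs').resolve_left he
    have : {t : F | q + w * t + e * t ^ 2 = h} = {w / e * s, w / e * s + w / e} := by
      ext t
      simp only [Set.mem_ofPred_eq, Set.mem_insert_iff, Set.mem_singleton_iff]
      have hwe : e * (w / e) = w := by field_simp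
      generalize w / e = r at *
      subst hwe
      constructor
      · intro ht
        have : e * ((t + r * s) * (t + (r * s + r))) = 0 := by grind
        have := (mul_eq_zero.1 this).resolve_left he
        rcases mul_eq_zero.1 this with h1 | h1
        · left; grind
        · right; grind
      · rintro (rfl | rfl) <;> grind
    rw [this, Set.ncard_pair]
    have : w / e ≠ 0 := div_ne_zero hw he
    intro h0
    grind
  · intro htr t ht
    apply htr
    rw [← trace_sq_add hF (e / w * t)]
    congr 1
    subst ht
    field_simp
    grind

theorem isMaximalArc_pencilUnion [Algebra (ZMod 2) F] (hF : Nat.card F = 2 ^ 7) {a b : F}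
    (ha : a ≠ 0) (hb : b ≠ 0) (hab : a ≠ b) :
    IsMaximalArc 4 (pencilUnion (1 : F) {a, b, a + b}) := by
  have := charP_two (F := F)
  have : Finite F := Nat.finite_of_card_ne_zero (by rw [hF]; norm_num)
  have hab' : a + b ≠ 0 := by grind
  refine ⟨⟨nucleus F, Or.inl rfl⟩, ?_, fun l => ?_⟩
  · intro h
    have hw : (![1, 0, 0] : Fin 3 → F) ≠ 0 := fun h => one_ne_zero (congrFun h 0)
    have h1 := Set.mem_univ (Projectivization.mk F _ hw)
    rw [← h, mk_mem_iff, mem_cone_pencilUnion_one hF] at h1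
    obtain ⟨_, k, _, hk⟩ := h1
    simp [normForm] at hk
  induction l using Projectivization.ind with
  | h w hw =>
    by_cases hw01 : w 0 = 0 ∧ w 1 = 0
    · left
      rw [pencilUnion_inter_line_infinity hF _ w hw hw01.1 hw01.2, Set.ncard_empty]
    obtain ⟨p, hp⟩ : ∃ p : Fin 2 → F, w 0 * p 0 + w 1 * p 1 = w 2 := by
      by_cases h1 : w 1 = 0
      · have h0 : w 0 ≠ 0 := fun h0 => hw01 ⟨h0, h1⟩
        exact ⟨![w 2 / w 0, 0], by simp; field_simp⟩
      · exact ⟨![0, w 2 / w 1], by simp; field_simp⟩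
    rw [ncard_pencilUnion_inter_line hF _ w hw hw01 p hp]
    have he : normForm (w 1) (w 0) ≠ 0 := fun h => hw01 (normForm_eq_zero hF h).symm
    have hq : w 2 ≠ 0 → ∀ t, normForm (p 0) (p 1) + w 2 * t + normForm (w 1) (w 0) * t ^ 2 ≠ 0 := by
      intro h2 t ht
      have : normForm (p 0 + t * w 1) (p 1 + t * w 0) = 0 := by
        rw [← ht]
        unfold normForm
        grind
      have := normForm_eq_zero hF this
      apply h2
      grind
    generalize normForm (p 0) (p 1) = q at *
    generalize normForm (w 1) (w 0) = e at *
    generalize w 2 = c at *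
    -- When c = 0 the line passes through the nucleus and squaring is bijective, giving 4 points.
    by_cases hc : c = 0
    · right
      subst hc
      have hinj : Function.Injective fun t : F => q + e * t ^ 2 := fun x y hxy =>
        sq_injective (mul_left_cancel₀ he (add_left_cancel hxy))
      have hsurj := Finite.surjective_of_injective hinj
      have : {t : F | q + 0 * t + e * t ^ 2 ∈ (insert 0 {a, b, a + b} : Set F)} =
          (fun t : F => q + e * t ^ 2) ⁻¹' {0, a, b, a + b} := by
        ext t
        simp
      rw [this, ← Set.ncard_image_of_injective _ hinj, Set.image_preimage_eq _ hsurj,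
        Set.ncard_insert_of_notMem (by simp [ha.symm, hb.symm, hab'.symm]),
        Set.ncard_insert_of_notMem (by simp [hab, hb]), Set.ncard_pair (by simp [ha])]
    · have hq := hq hc
      -- The line misses the nucleus, so the value 0 is not attained and τ q = 1. Hence h is
      -- attained, twice, exactly when τ h = 1. Since τ is additive, this happens for none or two of
      -- a, b, a + b.
      set τ : F → ZMod 2 := fun h => Algebra.trace (ZMod 2) F (h * e / c ^ 2) with hτ
      have hτadd : ∀ x y, τ (x + y) = τ x + τ y := fun x y => by
        simp only [hτ, add_mul, add_div, map_add]
      have hcases : ∀ x : ZMod 2, x = 0 ∨ x = 1 := by decide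
      have hτq : τ q = 1 := by
        refine (hcases _).resolve_left fun h0 => ?_
        obtain ⟨t, ht⟩ : Set.Nonempty {t : F | q + c * t + e * t ^ 2 = 0} := by
          apply Set.nonempty_of_ncard_ne_zero
          rw [(ncard_fibre hF hc he).1 (by rw [zero_add]; exact h0)]
          norm_num
        exact hq t ht
      have hone : ∀ h, τ h = 1 → {t : F | q + c * t + e * t ^ 2 = h}.ncard = 2 := fun h hh =>
        (ncard_fibre hF hc he).1 (by
          change τ (h + q) = 0
          rw [hτadd, hh, hτq]; rfl)
      have hzero : ∀ h, τ h = 0 → ∀ t, q + c * t + e * t ^ 2 ≠ h := fun h hh =>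
        (ncard_fibre hF hc he).2 (by
          change τ (h + q) ≠ 0
          rw [hτadd, hh, hτq]; decide)
      have htwo : ∀ x y z : F, x ≠ y → τ x = 1 → τ y = 1 → τ z = 0 →
          ({a, b, a + b} : Set F) = {x, y, z} →
          {t : F | q + c * t + e * t ^ 2 ∈ (insert 0 {a, b, a + b} : Set F)}.ncard = 4 := by
        intro x y z hxy hx hy hz hS
        have : {t : F | q + c * t + e * t ^ 2 ∈ (insert 0 {a, b, a + b} : Set F)} =
            {t : F | q + c * t + e * t ^ 2 = x} ∪ {t : F | q + c * t + e * t ^ 2 = y} := by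
          ext t
          simp only [hS, Set.mem_ofPred_eq, Set.mem_insert_iff, Set.mem_singleton_iff,
            Set.mem_union, hq t, hzero z hz t, false_or, or_false]
        rw [this, Set.ncard_union_eq, hone x hx, hone y hy]
        rw [Set.disjoint_left]
        intro t h1 h2
        exact hxy (h1.symm.trans h2)
      rcases hcases (τ a) with h1 | h1 <;> rcases hcases (τ b) with h2 | h2
      · left
        have h3 : τ (a + b) = 0 := by rw [hτadd, h1, h2]; rfl
        rw [Set.ncard_eq_zero]
        ext t
        simp [hq t, hzero a h1 t, hzero b h2 t, hzero _ h3 t]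
      · right
        have h3 : τ (a + b) = 1 := by rw [hτadd, h1, h2]; rfl
        exact htwo b (a + b) a (by simp [ha]) h2 h3 h1 (by ext; simp; tauto)
      · right
        have h3 : τ (a + b) = 1 := by rw [hτadd, h1, h2]; rfl
        exact htwo a (a + b) b (by simp [hb]) h1 h3 h2 (by ext; simp; tauto)
      · right
        have h3 : τ (a + b) = 0 := by rw [hτadd, h1, h2]; rfl
        exact htwo a b (a + b) hab h1 h2 h3 rfl

/-! ### Rigidity of the pencil under semilinear maps -/

section Rigidity

variable {F : Type*} [Field F]

theorem quartic_coeff_eq_zero {c₀ c₁ c₂ c₃ c₄ : F} {S : Finset F} (hS : 4 < S.card)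
    (h : ∀ s ∈ S, c₄ * s ^ 4 + c₃ * s ^ 3 + c₂ * s ^ 2 + c₁ * s + c₀ = 0) :
    c₀ = 0 ∧ c₁ = 0 ∧ c₂ = 0 ∧ c₃ = 0 ∧ c₄ = 0 := by
  open Polynomial in
  set p : F[X] := C c₄ * X ^ 4 + C c₃ * X ^ 3 + C c₂ * X ^ 2 + C c₁ * X + C c₀ with hp
  have hdeg : p.natDegree ≤ 4 := by rw [hp]; compute_degree
  have hp0 : p = 0 := p.eq_zero_of_natDegree_lt_card_of_eval_eq_zero' S
    (fun s hs => by simpa [hp] using h s hs) (hdeg.trans_lt hS)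
  have hc : ∀ n, p.coeff n = 0 := fun n => by rw [hp0, Polynomial.coeff_zero]
  have h0 := hc 0
  have h1 := hc 1
  have h2 := hc 2
  have h3 := hc 3
  have h4 := hc 4
  simp [hp, Polynomial.coeff_X, Polynomial.coeff_C, Polynomial.coeff_X_pow] at h0 h1 h2 h3 h4
  exact ⟨h0, h1, h2, h3, h4⟩

variable [CharP F 2]

/-- A quadratic form vanishing at five points of the conic `x² + x y + y² + m² z² = 0` is a multiple
of the form of that conic. -/
theorem quadratic_eq_of_vanish {m : F} (hm : m ≠ 0) {a b c d e g : F} {S : Finset F}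
    (hS : 4 < S.card)
    (h : ∀ s ∈ S, a * (s ^ 2) ^ 2 + b + c * ((s ^ 2 + s + 1) / m) ^ 2 + d * s ^ 2 +
      e * (s ^ 2 * ((s ^ 2 + s + 1) / m)) + g * ((s ^ 2 + s + 1) / m) = 0) :
    a = d ∧ b = d ∧ c = d * m ^ 2 ∧ e = 0 ∧ g = 0 := by
  -- On the parametrisation (s², 1, (s² + s + 1)/m) the form becomes a polynomial in s of degree at
  -- most 4 with at least five roots.
  obtain ⟨h0, h1, h2, h3, h4⟩ := quartic_coeff_eq_zero (c₀ := b + c / m ^ 2 + g / m) (c₁ := g / m)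
    (c₂ := c / m ^ 2 + d + e / m + g / m) (c₃ := e / m) (c₄ := a + c / m ^ 2 + e / m) hS (by
      intro s hs
      have := h s hs
      field_simp at this ⊢
      grind)
  have he : e = 0 := by simpa [hm] using h3
  have hg : g = 0 := by simpa [hm] using h1
  subst he hg
  have hc : c / m ^ 2 = d := by grind
  refine ⟨by grind, by grind, ?_, rfl, rfl⟩
  rw [← hc]
  field_simp

theorem exists_form_eq_mul (hF : Nat.card F = 2 ^ 7) (N : (Fin 3 → F) →ₗ[F] (Fin 3 → F))
    (hN : Function.Surjective N) (H : Finset F) (hH : H.card ≤ 4) {l : F} (hl : l ≠ 0)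
    (h : ∀ v : Fin 3 → F, v ≠ 0 → normForm (v 0) (v 1) = l * v 2 ^ 2 →
      ∃ x ∈ H, normForm (N v 0) (N v 1) = x * N v 2 ^ 2) :
    ∃ x ∈ H, ∃ k ≠ 0, ∀ v, normForm (N v 0) (N v 1) + x * N v 2 ^ 2 =
      k * (normForm (v 0) (v 1) + l * v 2 ^ 2) := by
  classical
  have : Finite F := Nat.finite_of_card_ne_zero (by rw [hF]; norm_num)
  have := Fintype.ofFinite F
  obtain ⟨m, rfl⟩ := exists_sq_eq hF l
  have hm : m ≠ 0 := by rintro rfl; simp at hl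
  let P : F → Fin 3 → F := fun s => ![s ^ 2, 1, (s ^ 2 + s + 1) / m]
  have hP : ∀ s, ∃ x ∈ H, normForm (N (P s) 0) (N (P s) 1) = x * N (P s) 2 ^ 2 := by
    intro s
    refine h _ (fun h0 => one_ne_zero (congrFun h0 1)) ?_
    simp only [P, normForm, Matrix.cons_val_zero, Matrix.cons_val_one, Matrix.cons_val]
    field_simp
    grind
  choose x hxH hx using hP
  -- Pigeonhole: the 128 parametrised points fall into at most 4 classes, so more than 4 share one
  -- value y.
  obtain ⟨y, hy, hcard⟩ := Finset.exists_lt_card_fiber_of_mul_lt_card_of_maps_to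
    (s := Finset.univ) (t := H) (f := x) (n := 4) (fun s _ => hxH s) (by
      rw [Finset.card_univ, Fintype.card_eq_nat_card, hF]; omega)
  refine ⟨y, hy, ?_⟩
  have hlin : ∀ v i, N v i = N (Pi.single 0 1) i * v 0 + N (Pi.single 1 1) i * v 1 +
      N (Pi.single 2 1) i * v 2 := by
    intro v i
    have hv : v = v 0 • Pi.single 0 1 + v 1 • Pi.single 1 1 + v 2 • Pi.single 2 1 := by
      ext j
      fin_cases j <;> simp
    conv_lhs => rw [hv]
    simp only [map_add, map_smul, Pi.add_apply, Pi.smul_apply, smul_eq_mul]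
    ring
  obtain ⟨a, b, c, d, e, g, hform⟩ : ∃ a b c d e g : F, ∀ v,
      normForm (N v 0) (N v 1) + y * N v 2 ^ 2 = a * v 0 ^ 2 + b * v 1 ^ 2 + c * v 2 ^ 2 +
        d * (v 0 * v 1) + e * (v 0 * v 2) + g * (v 1 * v 2) := by
    generalize N (Pi.single 0 1) = n₀ at hlin
    generalize N (Pi.single 1 1) = n₁ at hlin
    generalize N (Pi.single 2 1) = n₂ at hlin
    refine ⟨normForm (n₀ 0) (n₀ 1) + y * n₀ 2 ^ 2, normForm (n₁ 0) (n₁ 1) + y * n₁ 2 ^ 2,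
      normForm (n₂ 0) (n₂ 1) + y * n₂ 2 ^ 2,
      2 * n₀ 0 * n₁ 0 + (n₀ 0 * n₁ 1 + n₀ 1 * n₁ 0) + 2 * n₀ 1 * n₁ 1 + 2 * y * n₀ 2 * n₁ 2,
      2 * n₀ 0 * n₂ 0 + (n₀ 0 * n₂ 1 + n₀ 1 * n₂ 0) + 2 * n₀ 1 * n₂ 1 + 2 * y * n₀ 2 * n₂ 2,
      2 * n₁ 0 * n₂ 0 + (n₁ 0 * n₂ 1 + n₁ 1 * n₂ 0) + 2 * n₁ 1 * n₂ 1 + 2 * y * n₁ 2 * n₂ 2,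
      fun v => ?_⟩
    rw [hlin v 0, hlin v 1, hlin v 2]
    unfold normForm
    ring
  obtain ⟨rfl, rfl, rfl, rfl, rfl⟩ := quadratic_eq_of_vanish hm hcard (a := a) (b := b) (c := c)
    (d := d) (e := e) (g := g) (by
      intro s hs
      rw [Finset.mem_filter] at hs
      have h1 := hform (P s)
      have h2 := hx s
      rw [hs.2] at h2
      rw [h2, CharTwo.add_self_eq_zero] at h1
      rw [h1]
      simp [P])
  have hform' : ∀ v, normForm (N v 0) (N v 1) + y * N v 2 ^ 2 =
      b * (normForm (v 0) (v 1) + m ^ 2 * v 2 ^ 2) := by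
    intro v
    rw [hform, normForm]
    ring
  refine ⟨b, ?_, hform'⟩
  rintro rfl
  obtain ⟨v, hv⟩ := hN ![1, 0, 0]
  have := hform' v
  rw [hv] at this
  simp [normForm] at this

/-- In characteristic 2 the term in z² does not affect the polar form, which forces k = k'; the
difference of the two identities then shows that z² is preserved up to a scalar. The remaining z²
term in the pulled-back norm form vanishes because the preimage u of (0, 0, 1) is a period of that
form. -/
theorem linear_rigidity (N : (Fin 3 → F) →ₗ[F] (Fin 3 → F)) (hN : Function.Surjective N)
    {x y k k' l : F} (hk : k ≠ 0) (hl : l ≠ 1)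
    (hx : ∀ v, normForm (N v 0) (N v 1) + x * N v 2 ^ 2 = k * (normForm (v 0) (v 1) + v 2 ^ 2))
    (hy : ∀ v, normForm (N v 0) (N v 1) + y * N v 2 ^ 2 =
      k' * (normForm (v 0) (v 1) + l * v 2 ^ 2)) :
    ∃ r ≠ 0, (∀ v, N v 2 ^ 2 = r * v 2 ^ 2) ∧
      ∀ v, normForm (N v 0) (N v 1) = k * normForm (v 0) (v 1) := by
  have hkk : k' = k := by
    have h0 := hx ![1, 0, 0]
    have h0' := hy ![1, 0, 0]
    have h1 := hx ![0, 1, 0]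
    have h1' := hy ![0, 1, 0]
    have h2 := hx (![1, 0, 0] + ![0, 1, 0])
    have h2' := hy (![1, 0, 0] + ![0, 1, 0])
    rw [map_add] at h2 h2'
    simp only [Pi.add_apply] at h2 h2'
    generalize N ![1, 0, 0] = n₀ at *
    generalize N ![0, 1, 0] = n₁ at *
    simp [normForm] at *
    grind
  subst hkk
  have hl' : 1 + l ≠ 0 := fun h => hl (by grind)
  have hsum : ∀ v, (x + y) * N v 2 ^ 2 = k' * (1 + l) * v 2 ^ 2 := by
    intro v
    have h1 := hx v
    have h2 := hy v
    grind
  have hxy : x + y ≠ 0 := by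
    intro h0
    have := hsum ![0, 0, 1]
    simp [h0, hk, hl'] at this
  have hr : ∀ v, N v 2 ^ 2 = k' * (1 + l) / (x + y) * v 2 ^ 2 := by
    intro v
    have := hsum v
    field_simp
    linear_combination this
  have hr0 : k' * (1 + l) / (x + y) ≠ 0 := by positivity
  generalize k' * (1 + l) / (x + y) = r at hr hr0
  refine ⟨r, hr0, hr, ?_⟩
  have hq : ∀ v, normForm (N v 0) (N v 1) = k' * normForm (v 0) (v 1) + (k' + x * r) * v 2 ^ 2 := by
    intro v
    have h1 := hx v
    rw [hr] at h1
    grind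
  obtain ⟨u, hu⟩ := hN ![0, 0, 1]
  have hper : ∀ v, normForm (N (v + u) 0) (N (v + u) 1) = normForm (N v 0) (N v 1) := by
    intro v
    rw [map_add, hu]
    simp
  have hru := hr u
  have hu2 : u 2 ≠ 0 := by
    intro h0
    simp [hu, h0] at hru
  have h0 := hper 0
  have h1 := hper ![1, 0, 0]
  have h2 := hper ![0, 1, 0]
  rw [hq, hq] at h0 h1 h2
  have hmu : k' + x * r = 0 := by
    simp [normForm] at h0 h1 h2
    have hu1 : u 1 = 0 := by
      have : k' * u 1 = 0 := by grind
      exact (mul_eq_zero.1 this).resolve_left hk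
    have hu0 : u 0 = 0 := by
      have : k' * u 0 = 0 := by grind
      exact (mul_eq_zero.1 this).resolve_left hk
    simp [hu0, hu1, hu2] at h0
    exact h0
  intro v
  rw [hq, hmu]
  ring

/-- A point set isomorphic to a union of conics of the standard pencil that contains two conics of
the pencil is again a union of conics of the pencil. -/
theorem eq_pencilUnion_of_isomorphic (hF : Nat.card F = 2 ^ 7) {A : Set F}
    (hcard : (insert 0 A).ncard = 4) {K : Set (Point F)} (h : Isomorphic (pencilUnion 1 A) K)
    {l : F} (hl0 : l ≠ 0) (hl1 : l ≠ 1) (h1 : conic 1 1 1 ⊆ K) (hl : conic 1 1 l ⊆ K) :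
    ∃ (σ : F ≃+* F) (c : F), c ≠ 0 ∧ K = pencilUnion 1 ((fun x => c * σ x) '' A) := by
  classical
  have : Finite F := Nat.finite_of_card_ne_zero (by rw [hF]; norm_num)
  obtain ⟨σ, f, fadd, fsmul, fbij, fcone⟩ := h.symm.exists_map
  -- Composing with σ⁻¹ makes the map linear; the twist moves to the parameters, now collected in H.
  let N : (Fin 3 → F) →ₗ[F] (Fin 3 → F) :=
    { toFun := fun v i => σ.symm (f v i)
      map_add' := fun x y => by ext i; simp [fadd]
      map_smul' := fun c x => by ext i; simp [fsmul] }
  have hN : Function.Surjective N := by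
    intro w
    obtain ⟨v, hv⟩ := fbij.2 fun i => σ (w i)
    exact ⟨v, by ext i; simp [N, hv]⟩
  have f0 : f 0 = 0 := by
    have := fsmul 0 0
    simpa using this
  have hf0 : ∀ v, f v ≠ 0 ↔ v ≠ 0 := fun v => by
    have := fbij.1.ne_iff (x := v) (y := 0)
    rwa [f0] at this
  let H : Finset F := (Set.toFinite (insert 0 A)).toFinset.image σ.symm
  have hH : H.card ≤ 4 := Finset.card_image_le.trans (by
    rw [← hcard, Set.ncard_eq_toFinset_card])
  have hmem : ∀ v, v ∈ cone K ↔
      v ≠ 0 ∧ ∃ x ∈ H, normForm (N v 0) (N v 1) = x * N v 2 ^ 2 := by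
    intro v
    rw [fcone, mem_cone_pencilUnion_one hF, hf0]
    refine and_congr_right fun _ => ?_
    simp only [H, Finset.mem_image, Set.Finite.mem_toFinset]
    have : ∀ x, normForm (f v 0) (f v 1) = x * f v 2 ^ 2 ↔
        normForm (N v 0) (N v 1) = σ.symm x * N v 2 ^ 2 := by
      intro x
      rw [← σ.symm.injective.eq_iff]
      simp [N, normForm]
    simp only [this]
    constructor
    · rintro ⟨x, hx, hxe⟩
      exact ⟨_, ⟨x, hx, rfl⟩, hxe⟩
    · rintro ⟨_, ⟨x, hx, rfl⟩, hxe⟩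
      exact ⟨x, hx, hxe⟩
  have hsub : ∀ {l : F}, conic 1 1 l ⊆ K → ∀ v : Fin 3 → F, v ≠ 0 →
      normForm (v 0) (v 1) = l * v 2 ^ 2 →
      ∃ x ∈ H, normForm (N v 0) (N v 1) = x * N v 2 ^ 2 := fun hl v hv hve =>
    ((hmem v).1 (cone_mono hl ((mem_cone_conic_one _ _).2 ⟨hv, hve⟩))).2
  obtain ⟨x, _, k, hk, hx⟩ := exists_form_eq_mul hF N hN H hH one_ne_zero (hsub h1)
  obtain ⟨y, _, k', _, hy⟩ := exists_form_eq_mul hF N hN H hH hl0 (hsub hl)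
  simp only [one_mul] at hx
  obtain ⟨r, hr, hr2, hq⟩ := linear_rigidity N hN hk hl1 hx hy
  have hc : r / k ≠ 0 := div_ne_zero hr hk
  refine ⟨σ.symm, r / k, hc, cone_injective ?_⟩
  ext v
  rw [hmem, mem_cone_pencilUnion_one hF]
  refine and_congr_right fun _ => ?_
  have key : ∀ x, normForm (N v 0) (N v 1) = σ.symm x * N v 2 ^ 2 ↔
      normForm (v 0) (v 1) = r / k * σ.symm x * v 2 ^ 2 := by
    intro x
    rw [hq, hr2]
    constructor <;> intro h
    · field_simp
      linear_combination h
    · rw [h]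
      field_simp
  have hH' : ∀ p : F → Prop, (∃ x ∈ H, p x) ↔ ∃ x ∈ insert 0 A, p (σ.symm x) := by
    intro p
    simp only [H, Finset.mem_image, Set.Finite.mem_toFinset, exists_exists_and_eq_and]
  rw [hH']
  simp only [key, Set.exists_mem_insert, Set.exists_mem_image, map_zero, mul_zero]

end Rigidity

/-! ### Denniston 4-arcs through C₁ -/

/-- The union of the conics of the standard pencil with parameters `1`, `b`, `1 + b`. -/
def arc {F : Type*} [Field F] (b : F) : Set (Point F) := pencilUnion 1 {1, b, 1 + b}

/-- The invariant of the action of the symmetric group `S₃` on the line minus `0, 1, ∞` in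
characteristic two. -/
noncomputable def jInv {F : Type*} [Field F] (b : F) : F := (b ^ 2 + b + 1) ^ 3 / (b ^ 2 + b) ^ 2

theorem conic_one_subset_arc {F : Type*} [Field F] (b : F) : conic 1 1 1 ⊆ arc b :=
  conic_subset_pencilUnion (by simp) 1

theorem conic_subset_arc {F : Type*} [Field F] (b : F) : conic 1 1 b ⊆ arc b :=
  conic_subset_pencilUnion (by simp) 1

section Arcs

variable {F : Type*} [Field F] [Algebra (ZMod 2) F]

theorem zero_notMem_params {b : F} (h0 : b ≠ 0) (h1 : b ≠ 1) : (0 : F) ∉ ({1, b, 1 + b} : Set F) := by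
  have := charP_two (F := F)
  have : 1 + b ≠ 0 := fun h => h1 (by grind)
  simp [h0.symm, this.symm]

theorem isDennistonType_of_isomorphic (hF : Nat.card F = 2 ^ 7) {b : F} (h0 : b ≠ 0) (h1 : b ≠ 1)
    {K : Set (Point F)} (h : Isomorphic (arc b) K) : IsDennistonType K := by
  have := charP_two (F := F)
  refine ⟨1, {1, b, 1 + b}, trace_one hF, zero_notMem_params h0 h1, ?_, h⟩
  simp only [Set.mem_union, Set.mem_insert_iff, Set.mem_singleton_iff]
  grind

theorem eq_triple {A : Set F} (hA : (insert 0 A).ncard = 4) (hA0 : (0 : F) ∉ A)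
    (hadd : ∀ a ∈ A ∪ {0}, ∀ b ∈ A ∪ {0}, a + b ∈ A ∪ {0}) {a b : F} (ha : a ∈ A) (hb : b ∈ A)
    (hab : a ≠ b) : A = {a, b, a + b} := by
  have := charP_two (F := F)
  have hab0 : a + b ≠ 0 := by grind
  have hsum : a + b ∈ A := (hadd a (Or.inl ha) b (Or.inl hb)).resolve_right hab0
  have ha0 : a ≠ 0 := fun h => hA0 (h ▸ ha)
  have hb0 : b ≠ 0 := fun h => hA0 (h ▸ hb)
  have hfin : (insert 0 A).Finite := Set.finite_of_ncard_ne_zero (by rw [hA]; norm_num)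
  have hfin' : A.Finite := hfin.subset (Set.subset_insert _ _)
  rw [Set.ncard_insert_of_notMem hA0 hfin'] at hA
  refine (Set.eq_of_subset_of_ncard_le ?_ ?_ hfin').symm
  · rintro x (rfl | rfl | rfl) <;> assumption
  · rw [Set.ncard_insert_of_notMem (by simp [hab, hb0]), Set.ncard_pair (by simp [ha0])]
    omega

variable [DecidableEq F]

theorem isDenniston4Arc_arc (hF : Nat.card F = 2 ^ 7) {b : F} (h0 : b ≠ 0) (h1 : b ≠ 1) :
    IsDenniston4Arc (arc b) :=
  ⟨isMaximalArc_pencilUnion hF one_ne_zero h0 h1.symm,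
    isDennistonType_of_isomorphic hF h0 h1 (Isomorphic.refl _)⟩

theorem IsDenniston4Arc.exists_isomorphic (hF : Nat.card F = 2 ^ 7) {K : Set (Point F)}
    (hK : IsDenniston4Arc K) :
    ∃ A : Set F, (0 : F) ∉ A ∧ (insert 0 A).ncard = 4 ∧
      (∀ a ∈ A ∪ {0}, ∀ b ∈ A ∪ {0}, a + b ∈ A ∪ {0}) ∧ Isomorphic (pencilUnion 1 A) K := by
  have := charP_two (F := F)
  obtain ⟨hmax, α, A, hα, hA0, hadd, hiso⟩ := hK
  have hiso' := (exists_isomorphic_pencilUnion_one hF hα A).symm.trans hiso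
  exact ⟨A, hA0, ncard_of_isMaximalArc hF (hmax.of_isomorphic hiso'), hadd, hiso'⟩

theorem IsDenniston4Arc.exists_arc_isomorphic (hF : Nat.card F = 2 ^ 7) {K : Set (Point F)}
    (hK : IsDenniston4Arc K) : ∃ b : F, b ≠ 0 ∧ b ≠ 1 ∧ Isomorphic (arc b) K := by
  have := charP_two (F := F)
  obtain ⟨A, hA0, hcard, hadd, hiso⟩ := hK.exists_isomorphic hF
  have hfin' : A.Finite := (Set.finite_of_ncard_ne_zero (by rw [hcard]; norm_num)).subset
    (Set.subset_insert 0 A)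
  have hcard' := hcard
  rw [Set.ncard_insert_of_notMem hA0 hfin'] at hcard'
  obtain ⟨a, ha, b, hb, hab⟩ := (Set.one_lt_ncard hfin').1 (by omega : 1 < A.ncard)
  have hA := eq_triple hcard hA0 hadd ha hb hab
  have ha0 : a ≠ 0 := fun h => hA0 (h ▸ ha)
  have hb0 : b ≠ 0 := fun h => hA0 (h ▸ hb)
  refine ⟨b / a, div_ne_zero hb0 ha0, fun h => hab ((div_eq_one_iff_eq ha0).1 h).symm, ?_⟩
  refine (isomorphic_pencilUnion hF (RingEquiv.refl F) ha0 fun x => ?_).trans hiso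
  have h1 : a * x = b ↔ x = b / a := by rw [eq_div_iff ha0, mul_comm]
  have h2 : a * x = a + b ↔ x = 1 + b / a := by
    constructor
    · intro h
      field_simp
      linear_combination h
    · rintro rfl
      field_simp
  simp only [hA, RingEquiv.refl_apply, Set.mem_insert_iff, Set.mem_singleton_iff, mul_eq_zero, ha0,
    false_or, mul_eq_left₀ ha0, h1, h2]

/-- By rigidity the parameters of K are a scaled, twisted copy of a group of order 4 without 0;
containing 1 and b, the copy must have 1 + b as third element. -/
theorem IsDenniston4Arc.eq_arc (hF : Nat.card F = 2 ^ 7) {K : Set (Point F)}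
    (hK : IsDenniston4Arc K) {b : F} (h0 : b ≠ 0) (h1 : b ≠ 1) (h1K : conic 1 1 1 ⊆ K)
    (hbK : conic 1 1 b ⊆ K) : K = arc b := by
  have := charP_two (F := F)
  obtain ⟨A, hA0, hcard, hadd, hiso⟩ := hK.exists_isomorphic hF
  obtain ⟨σ, c, hc, rfl⟩ := eq_pencilUnion_of_isomorphic hF hcard hiso h0 h1 h1K hbK
  obtain ⟨x, hx, hx1⟩ := (mem_of_conic_subset hF h1K).resolve_left one_ne_zero
  obtain ⟨y, hy, hyb⟩ := (mem_of_conic_subset hF hbK).resolve_left h0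
  have hxy : x ≠ y := by
    rintro rfl
    exact h1 (hyb.symm.trans hx1)
  rw [arc, eq_triple hcard hA0 hadd hx hy hxy]
  congr 1
  simp only [Set.image_insert_eq, Set.image_singleton, map_add, mul_add]
  simp only at hx1 hyb
  rw [hx1, hyb]

theorem generates_iff (hF : Nat.card F = 2 ^ 7) {b : F} (h0 : b ≠ 0) (h1 : b ≠ 1)
    {K : Set (Point F)} : Generates (conic 1 1 1) (conic 1 1 b) K ↔ K = arc b := by
  constructor
  · rintro ⟨⟨hK, hsub⟩, -⟩
    exact hK.eq_arc hF h0 h1 (Set.union_subset_iff.1 hsub).1 (Set.union_subset_iff.1 hsub).2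
  · rintro rfl
    refine ⟨⟨isDenniston4Arc_arc hF h0 h1,
      Set.union_subset (conic_one_subset_arc b) (conic_subset_arc b)⟩, fun K' hK' hsub => ?_⟩
    exact hK'.eq_arc hF h0 h1 (Set.union_subset_iff.1 hsub).1 (Set.union_subset_iff.1 hsub).2

theorem mem_denniston4ArcsInPencil (hF : Nat.card F = 2 ^ 7) {K : Set (Point F)} :
    K ∈ denniston4ArcsInPencil (1 : F) ↔ ∃ b : F, (b ≠ 0 ∧ b ≠ 1) ∧ arc b = K := by
  have := charP_two (F := F)
  constructor
  · rintro ⟨hK, h1K, A, hA0, rfl⟩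
    have h1A := (mem_of_conic_subset hF h1K).resolve_left one_ne_zero
    have hcard := ncard_of_isMaximalArc hF hK.1
    have hfin' : A.Finite := (Set.finite_of_ncard_ne_zero (by rw [hcard]; norm_num)).subset
      (Set.subset_insert 0 A)
    rw [Set.ncard_insert_of_notMem hA0 hfin'] at hcard
    obtain ⟨b, hb, hb1⟩ := Set.exists_ne_of_one_lt_ncard (by omega : 1 < A.ncard) 1
    have hb0 : b ≠ 0 := fun h => hA0 (h ▸ hb)
    exact ⟨b, ⟨hb0, hb1⟩, (hK.eq_arc hF hb0 hb1 h1K (conic_subset_pencilUnion hb 1)).symm⟩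
  · rintro ⟨b, ⟨h0, h1⟩, rfl⟩
    exact ⟨isDenniston4Arc_arc hF h0 h1, conic_one_subset_arc b, _, zero_notMem_params h0 h1, rfl⟩

theorem mem_denniston4Classes (hF : Nat.card F = 2 ^ 7) {T : Set (Set (Point F))} :
    T ∈ denniston4Classes F ↔ ∃ b : F, (b ≠ 0 ∧ b ≠ 1) ∧ {K | Isomorphic (arc b) K} = T := by
  constructor
  · rintro ⟨D, hD, rfl⟩
    obtain ⟨b, h0, h1, hb⟩ := hD.exists_arc_isomorphic hF
    exact ⟨b, ⟨h0, h1⟩, Set.ext fun K => ⟨hb.symm.trans, hb.trans⟩⟩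
  · rintro ⟨b, ⟨h0, h1⟩, rfl⟩
    exact ⟨_, isDenniston4Arc_arc hF h0 h1, rfl⟩

omit [DecidableEq F]

theorem arc_eq_iff (hF : Nat.card F = 2 ^ 7) {b c : F} (h0 : b ≠ 0) (h1 : b ≠ 1) (h0' : c ≠ 0)
    (h1' : c ≠ 1) : arc c = arc b ↔ c = b ∨ c = 1 + b := by
  have := charP_two (F := F)
  constructor
  · intro h
    have h := pencilUnion_injective hF (zero_notMem_params h0' h1') (zero_notMem_params h0 h1) h
    have hc : c ∈ ({1, c, 1 + c} : Set F) := by simp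
    rw [h] at hc
    simpa [h1'] using hc
  · rintro (rfl | rfl)
    · rfl
    · rw [arc, arc, show 1 + (1 + b) = b by grind, Set.pair_comm]

end Arcs

/-! ### The S₃-invariant and its Frobenius conjugates -/

section Invariant

variable {F : Type*} [Field F] [CharP F 2]

theorem jInv_eq_iff {b c : F} (h0 : b ≠ 0) (h1 : b ≠ 1) (h0' : c ≠ 0) (h1' : c ≠ 1) :
    jInv c = jInv b ↔ c = b ∨ c = 1 + b ∨ c = 1 / b ∨ c = (1 + b) / b ∨ c = 1 / (1 + b) ∨
      c = b / (1 + b) := by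
  have hb : 1 + b ≠ 0 := fun h => h1 (by grind)
  have hc : 1 + c ≠ 0 := fun h => h1' (by grind)
  have hbb : b ^ 2 + b = b * (1 + b) := by ring
  have hcc : c ^ 2 + c = c * (1 + c) := by ring
  rw [jInv, jInv, hbb, hcc, div_eq_div_iff (by simp [h0', hc]) (by simp [h0, hb]),
    eq_div_iff h0, eq_div_iff h0, eq_div_iff hb, eq_div_iff hb]
  constructor
  · intro h
    -- After clearing denominators, the difference of the two invariants splits into six factors
    -- linear in c, one for each element of S₃.
    have : (c + b) * ((c + (1 + b)) * ((c * b + 1) * ((c * b + (1 + b)) *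
        ((c * (1 + b) + 1) * (c * (1 + b) + b))))) = 0 := by grind
    simp only [mul_eq_zero] at this
    rcases this with h | h | h | h | h | h
    · left; grind
    · right; left; grind
    · right; right; left; grind
    · right; right; right; left; grind
    · right; right; right; right; left; grind
    · right; right; right; right; right; grind
  · have : ∀ x : F, x + x = 0 := fun x => CharTwo.add_self_eq_zero x
    rintro (h | h | h | h | h | h) <;> grind

theorem jInv_ne_zero (hF : Nat.card F = 2 ^ 7) {b : F} (h0 : b ≠ 0) (h1 : b ≠ 1) :
    jInv b ≠ 0 := by
  have hb : 1 + b ≠ 0 := fun h => h1 (by grind)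
  have hbb : b ^ 2 + b ≠ 0 := by
    rw [show b ^ 2 + b = b * (1 + b) by ring]
    exact mul_ne_zero h0 hb
  exact div_ne_zero (pow_ne_zero _ (sq_add_self_add_one_ne_zero hF b)) (pow_ne_zero _ hbb)

theorem jInv_ne_one (hF : Nat.card F = 2 ^ 7) {b : F} (h0 : b ≠ 0) (h1 : b ≠ 1) :
    jInv b ≠ 1 := by
  have hb : 1 + b ≠ 0 := fun h => h1 (by grind)
  have hbb : b ^ 2 + b ≠ 0 := by
    rw [show b ^ 2 + b = b * (1 + b) by ring]
    exact mul_ne_zero h0 hb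
  unfold jInv
  intro h
  rw [div_eq_one_iff_eq (pow_ne_zero _ hbb)] at h
  generalize b ^ 2 + b = w at *
  -- With w = b² + b the condition is (w + 1)³ = w². Its roots are seventh roots of unity, lying in
  -- the field of order 8, and 7 does not divide 127.
  have hw : w ^ 3 + w + 1 = 0 := by grind
  have h7 : w ^ 7 = 1 := by grind
  have h128 : w ^ 128 = w ^ 2 := by
    rw [show 128 = 7 * 18 + 2 from rfl, pow_add, pow_mul, h7, one_pow, one_mul]
  rw [pow_card_128 hF] at h128
  grind

omit [CharP F 2] in
theorem map_jInv (σ : F ≃+* F) (b : F) : jInv (σ b) = σ (jInv b) := by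
  simp [jInv]

theorem pow_two_pow_injOn (hF : Nat.card F = 2 ^ 7) {y : F} (h0 : y ≠ 0) (h1 : y ≠ 1) :
    Set.InjOn (fun i => y ^ 2 ^ i) (Finset.range 7 : Set ℕ) := by
  have key : ∀ i k, k < 7 → y ^ 2 ^ (i + k) = y ^ 2 ^ i → k = 0 := by
    intro i k hk h
    by_contra hk0
    rw [add_comm, pow_add, pow_mul] at h
    have h' : y ^ 2 ^ k = y := iterateFrobenius_inj F 2 i (by simpa [iterateFrobenius_def] using h)
    have h127 : y ^ 127 = 1 := by
      apply mul_right_cancel₀ h0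
      rw [← pow_succ, one_mul]
      exact pow_card_128 hF y
    have hk1 : y ^ (2 ^ k - 1) = 1 := by
      apply mul_right_cancel₀ h0
      rw [← pow_succ, Nat.sub_add_cancel Nat.one_le_two_pow, one_mul, h']
    have hd := Nat.dvd_gcd (orderOf_dvd_of_pow_eq_one h127) (orderOf_dvd_of_pow_eq_one hk1)
    -- 127 is prime and 0 < 2^k - 1 < 127.
    have hg : Nat.gcd 127 (2 ^ k - 1) = 1 := by
      interval_cases k <;> first | rfl | exact (hk0 rfl).elim
    rw [hg, Nat.dvd_one, orderOf_eq_one_iff] at hd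
    exact h1 hd
  intro i hi j hj hij
  simp only [Finset.coe_range, Set.mem_Iio] at hi hj
  simp only at hij
  rcases le_total i j with h | h
  · obtain ⟨k, rfl⟩ := Nat.exists_eq_add_of_le h
    have := key i k (by omega) hij.symm
    omega
  · obtain ⟨k, rfl⟩ := Nat.exists_eq_add_of_le h
    have := key j k (by omega) hij
    omega

end Invariant

/-! ### Isomorphism of arcs in terms of the invariant -/

section Isomorphism

variable {F : Type*} [Field F] [Algebra (ZMod 2) F]

theorem ringEquiv_eq_pow (hF : Nat.card F = 2 ^ 7) (σ : F ≃+* F) :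
    ∃ i < 7, ∀ x, σ x = x ^ 2 ^ i := by
  have : Finite F := Nat.finite_of_card_ne_zero (by rw [hF]; norm_num)
  let e : F ≃ₐ[ZMod 2] F := AlgEquiv.ofRingEquiv (f := σ) fun r =>
    RingHom.congr_fun (Subsingleton.elim ((σ : F →+* F).comp (algebraMap (ZMod 2) F))
      (algebraMap (ZMod 2) F)) r
  obtain ⟨i, hi⟩ := (FiniteField.bijective_frobeniusAlgEquivOfAlgebraic_pow (ZMod 2) F).2 e
  refine ⟨i, (finrank_eq_seven hF) ▸ i.2, fun x => ?_⟩
  have h := DFunLike.congr_fun hi x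
  simp only [AlgEquiv.coe_pow, FiniteField.coe_frobeniusAlgEquivOfAlgebraic_iterate] at h
  rw [ZMod.card] at h
  exact h.symm

theorem isomorphic_arc_of_jInv (hF : Nat.card F = 2 ^ 7) (σ : F ≃+* F) {b c : F} (h0 : b ≠ 0)
    (h1 : b ≠ 1) (h0' : c ≠ 0) (h1' : c ≠ 1) (h : jInv c = jInv (σ b)) :
    Isomorphic (arc b) (arc c) := by
  have := charP_two (F := F)
  have hu0 : σ b ≠ 0 := by simpa using h0
  have hu1 : σ b ≠ 1 := by simpa using h1
  have hu2 : 1 + σ b ≠ 0 := fun h => hu1 (by grind)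
  rw [jInv_eq_iff hu0 hu1 h0' h1'] at h
  -- The scalar k divides by the element of {1, σ b, 1 + σ b} that is to become 1; the six cases for
  -- c use each of the three scalars twice.
  have key : ∀ k : F, k ≠ 0 → (∀ x : F, (x = 0 ∨ x = 1 ∨ x = σ b ∨ x = 1 + σ b) ↔
      (k * x = 0 ∨ k * x = 1 ∨ k * x = c ∨ k * x = 1 + c)) → Isomorphic (arc b) (arc c) := by
    intro k hk hx
    refine isomorphic_pencilUnion hF σ hk fun x => ?_
    have := hx (σ x)
    have e0 : σ x = 0 ↔ x = 0 := by simp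
    have e1 : σ x = 1 ↔ x = 1 := by simp
    have e2 : σ x = σ b ↔ x = b := σ.injective.eq_iff
    have e3 : σ x = 1 + σ b ↔ x = 1 + b := by
      rw [show 1 + σ b = σ (1 + b) by simp]
      exact σ.injective.eq_iff
    rw [e0, e1, e2, e3] at this
    simpa only [Set.mem_insert_iff, Set.mem_singleton_iff] using this
  generalize σ b = u at *
  rcases h with h | h | h | h | h | h
  · exact key 1 one_ne_zero fun x => by subst h; grind
  · exact key 1 one_ne_zero fun x => by subst h; grind
  · refine key (1 / u) (one_div_ne_zero hu0) fun x => ?_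
    subst h; field_simp; grind
  · refine key (1 / u) (one_div_ne_zero hu0) fun x => ?_
    subst h; field_simp; grind
  · refine key (1 / (1 + u)) (one_div_ne_zero hu2) fun x => ?_
    subst h; field_simp; grind
  · refine key (1 / (1 + u)) (one_div_ne_zero hu2) fun x => ?_
    subst h; field_simp; grind

theorem isomorphic_arc_iff (hF : Nat.card F = 2 ^ 7) {b c : F} (h0 : b ≠ 0)
    (h1 : b ≠ 1) (h0' : c ≠ 0) (h1' : c ≠ 1) :
    Isomorphic (arc b) (arc c) ↔ ∃ i < 7, jInv c = jInv b ^ 2 ^ i := by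
  have := charP_two (F := F)
  have : Finite F := Nat.finite_of_card_ne_zero (by rw [hF]; norm_num)
  constructor
  · intro h
    have hb2 : 1 + b ≠ 0 := fun h => h1 (by grind)
    have hcard : (insert 0 {1, b, 1 + b} : Set F).ncard = 4 := by
      rw [Set.ncard_insert_of_notMem (zero_notMem_params h0 h1),
        Set.ncard_insert_of_notMem (by simp [h1.symm, h0]), Set.ncard_pair (by simp)]
    obtain ⟨σ, k, hk, he⟩ := eq_pencilUnion_of_isomorphic hF hcard h h0' h1'
      (conic_one_subset_arc c) (conic_subset_arc c)
    have h1c := (mem_of_conic_subset hF ((conic_one_subset_arc c).trans he.subset)).resolve_left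
      one_ne_zero
    have hcc := (mem_of_conic_subset hF ((conic_subset_arc c).trans he.subset)).resolve_left h0'
    have hu0 : σ b ≠ 0 := by simpa using h0
    have hu1 : σ b ≠ 1 := by simpa using h1
    have hu2 : 1 + σ b ≠ 0 := fun h => hu1 (by grind)
    have hj : jInv c = jInv (σ b) := by
      rw [jInv_eq_iff hu0 hu1 h0' h1']
      simp only [Set.image_insert_eq, Set.image_singleton, map_add, map_one,
        Set.mem_insert_iff, Set.mem_singleton_iff] at h1c hcc
      rw [eq_div_iff hu0, eq_div_iff hu0, eq_div_iff hu2, eq_div_iff hu2]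
      generalize σ b = u at *
      rcases h1c with h | h | h <;> rcases hcc with h' | h' | h' <;> grind
    obtain ⟨i, hi, hσ⟩ := ringEquiv_eq_pow hF σ
    exact ⟨i, hi, by rw [hj, map_jInv, hσ]⟩
  · rintro ⟨i, -, hi⟩
    refine isomorphic_arc_of_jInv hF (iterateFrobeniusEquiv F 2 i) h0 h1 h0' h1' ?_
    rw [map_jInv, iterateFrobeniusEquiv_def, hi]

end Isomorphism

/-! ### Counting parameters and arcs -/

section Counting

open Finset

theorem card_eq_mul_card_image {α β : Type*} [DecidableEq α] [DecidableEq β] (s : Finset α)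
    (f : α → β) (n : ℕ) (h : ∀ a ∈ s, #{x ∈ s | f x = f a} = n) : #s = #(s.image f) * n := by
  rw [card_eq_sum_card_image f s]
  refine sum_const_nat fun b hb => ?_
  obtain ⟨a, ha, rfl⟩ := mem_image.1 hb
  exact h a ha

variable {F : Type*} [Field F]

theorem one_add_mem_params [Algebra (ZMod 2) F] {b : F} (h : b ≠ 0 ∧ b ≠ 1) : 1 + b ≠ 0 ∧ 1 + b ≠ 1 := by
  have := charP_two (F := F)
  exact ⟨fun h' => h.2 (by grind), by simpa using h.1⟩

theorem arc_one_add [Algebra (ZMod 2) F] {b : F} : arc (1 + b) = arc b := by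
  have := charP_two (F := F)
  rw [arc, arc, show 1 + (1 + b) = b by grind, Set.pair_comm]

variable [Fintype F] [DecidableEq F]

/-- The elements of the field different from `0` and `1`. -/
def params (F : Type*) [Field F] [Fintype F] [DecidableEq F] : Finset F := {b | b ≠ 0 ∧ b ≠ 1}

theorem mem_params {b : F} : b ∈ params F ↔ b ≠ 0 ∧ b ≠ 1 := by simp [params]

theorem card_params (hF : Nat.card F = 2 ^ 7) : #(params F) = 126 := by
  have : params F = univ \ {0, 1} := by
    ext x
    simp [params]
  rw [this, card_sdiff_of_subset (subset_univ _), card_univ, card_pair zero_ne_one,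
    Fintype.card_eq_nat_card, hF]
  norm_num

theorem card_jInv_fibre [CharP F 2] (hF : Nat.card F = 2 ^ 7) {b : F} (h0 : b ≠ 0) (h1 : b ≠ 1) :
    #{c ∈ params F | jInv c = jInv b} = 6 := by
  have hb : 1 + b ≠ 0 := fun h => h1 (by grind)
  have hbb : b ^ 2 + b + 1 ≠ 0 := sq_add_self_add_one_ne_zero hF b
  have : ({c ∈ params F | jInv c = jInv b} : Finset F) =
      {b, 1 + b, 1 / b, (1 + b) / b, 1 / (1 + b), b / (1 + b)} := by
    ext c
    simp only [mem_filter, mem_params, mem_insert, mem_singleton]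
    constructor
    · rintro ⟨⟨h0', h1'⟩, h⟩
      exact (jInv_eq_iff h0 h1 h0' h1').1 h
    · intro h
      have hc : c ≠ 0 ∧ c ≠ 1 := by
        rcases h with rfl | rfl | rfl | rfl | rfl | rfl
        · exact ⟨h0, h1⟩
        · exact ⟨hb, by simpa using h0⟩
        · exact ⟨one_div_ne_zero h0, by rw [Ne, div_eq_one_iff_eq h0]; exact h1.symm⟩
        · exact ⟨div_ne_zero hb h0, by rw [Ne, div_eq_one_iff_eq h0]; simp⟩
        · exact ⟨one_div_ne_zero hb, by rw [Ne, div_eq_one_iff_eq hb]; simpa using h0⟩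
        · exact ⟨div_ne_zero h0 hb, by rw [Ne, div_eq_one_iff_eq hb]; simp⟩
      exact ⟨hc, (jInv_eq_iff h0 h1 hc.1 hc.2).2 h⟩
  rw [this]
  repeat rw [card_insert_of_notMem]
  · simp
  all_goals
    simp only [mem_insert, mem_singleton, not_or]
    grind

/-- The parameters `c` for which the arc with parameter `c` is isomorphic to that of `b`. -/
noncomputable def isoParams (b : F) : Finset F :=
  open Classical in {c ∈ params F | Isomorphic (arc b) (arc c)}

theorem mem_isoParams {b c : F} :
    c ∈ isoParams b ↔ (c ≠ 0 ∧ c ≠ 1) ∧ Isomorphic (arc b) (arc c) := by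
  simp [isoParams, mem_params]

variable [Algebra (ZMod 2) F]

/-- Seven disjoint fibres of `jInv`, one over each Frobenius conjugate of `jInv b`; each is the
fibre through a conjugate of b and has six elements. -/
theorem card_isoParams (hF : Nat.card F = 2 ^ 7) {b : F} (h0 : b ≠ 0) (h1 : b ≠ 1) :
    #(isoParams b) = 42 := by
  have := charP_two (F := F)
  have : isoParams b =
      (range 7).biUnion fun i => {c ∈ params F | jInv c = jInv b ^ 2 ^ i} := by
    ext c
    simp only [isoParams, mem_filter, mem_biUnion, mem_range]
    constructor
    · rintro ⟨hc, h⟩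
      obtain ⟨i, hi, hj⟩ :=
        (isomorphic_arc_iff hF h0 h1 (mem_params.1 hc).1 (mem_params.1 hc).2).1 h
      exact ⟨i, hi, hc, hj⟩
    · rintro ⟨i, hi, hc, hj⟩
      exact ⟨hc,
        (isomorphic_arc_iff hF h0 h1 (mem_params.1 hc).1 (mem_params.1 hc).2).2 ⟨i, hi, hj⟩⟩
  rw [this, card_biUnion]
  · rw [sum_const_nat (m := 6), card_range]
    intro i _
    have h := card_jInv_fibre hF (b := iterateFrobeniusEquiv F 2 i b)
      ((map_ne_zero_iff _ (iterateFrobeniusEquiv F 2 i).injective).2 h0)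
      ((map_ne_one_iff _ (iterateFrobeniusEquiv F 2 i).injective).2 h1)
    rw [map_jInv, iterateFrobeniusEquiv_def] at h
    exact h
  · intro i hi j hj hij
    rw [Function.onFun, disjoint_left]
    intro c hc hc'
    rw [mem_filter] at hc hc'
    exact hij (pow_two_pow_injOn hF (jInv_ne_zero hF h0 h1) (jInv_ne_one hF h0 h1) hi hj
      (hc.2.symm.trans hc'.2))

omit [Fintype F] in
theorem card_eq_two_mul_card_image_arc [Finite F] (hF : Nat.card F = 2 ^ 7) (s : Finset F)
    (hs : ∀ b ∈ s, (b ≠ 0 ∧ b ≠ 1) ∧ 1 + b ∈ s) :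
    #s = (arc '' (s : Set F)).ncard * 2 := by
  classical
  rw [← coe_image, Set.ncard_coe_finset]
  refine card_eq_mul_card_image s arc 2 fun b hb => ?_
  obtain ⟨⟨h0, h1⟩, hb'⟩ := hs b hb
  have : ({x ∈ s | arc x = arc b} : Finset F) = {b, 1 + b} := by
    ext c
    simp only [mem_filter, mem_insert, mem_singleton]
    constructor
    · rintro ⟨hc, h⟩
      exact (arc_eq_iff hF h0 h1 (hs c hc).1.1 (hs c hc).1.2).1 h
    · intro h
      have hc : c ∈ s := by rcases h with rfl | rfl <;> assumption
      exact ⟨hc, (arc_eq_iff hF h0 h1 (hs c hc).1.1 (hs c hc).1.2).2 h⟩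
  rw [this, card_pair]
  simp

end Counting

end PG2

/-! ### The theorem -/

theorem mainTheorem8 {F : Type*} [Field F] [DecidableEq F] [Algebra (ZMod 2) F]
    (hF : Nat.card F = 2 ^ 7) :
    (PG2.denniston4Classes F).ncard = 3 ∧
    (∀ T ∈ PG2.denniston4Classes F,
      {C : Set (PG2.Point F) | C ∈ PG2.standardPencil (1 : F) ∧ C ≠ PG2.conic 1 1 1 ∧
        ∃ K ∈ T, PG2.Generates (PG2.conic 1 1 1) C K}.ncard = 42) ∧
    (PG2.denniston4ArcsInPencil (1 : F)).ncard = 63 ∧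
    (∀ T ∈ PG2.denniston4Classes F,
      {K : Set (PG2.Point F) | K ∈ PG2.denniston4ArcsInPencil (1 : F) ∧ K ∈ T}.ncard = 21) := by
  classical
  have : Finite F := Nat.finite_of_card_ne_zero (by rw [hF]; norm_num)
  have := Fintype.ofFinite F
  have := PG2.charP_two (F := F)
  refine ⟨?_, ?_, ?_, ?_⟩
  · have himg : PG2.denniston4Classes F =
        ((PG2.params F).image fun b => {K | PG2.Isomorphic (PG2.arc b) K} :
          Finset (Set (Set (PG2.Point F)))) := by
      ext T
      simp only [PG2.mem_denniston4Classes hF, Finset.coe_image, Set.mem_image, Finset.mem_coe,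
        PG2.mem_params]
    rw [himg, Set.ncard_coe_finset]
    -- All fibres of the map from parameters to classes have 42 elements, so 126 = 42 · 3.
    have h := PG2.card_eq_mul_card_image (PG2.params F)
      (fun b => {K | PG2.Isomorphic (PG2.arc b) K}) 42 fun b hb => by
        rw [← PG2.card_isoParams hF (PG2.mem_params.1 hb).1 (PG2.mem_params.1 hb).2]
        congr 1
        ext c
        rw [Finset.mem_filter, PG2.mem_isoParams, PG2.mem_params]
        refine and_congr_right fun _ => ⟨fun h => ?_, fun h => ?_⟩
        · exact (h ▸ PG2.Isomorphic.refl (PG2.arc c) :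
            PG2.arc c ∈ {K | PG2.Isomorphic (PG2.arc b) K})
        · ext K
          exact ⟨h.trans, h.symm.trans⟩
    rw [PG2.card_params hF] at h
    omega
  · intro T hT
    obtain ⟨b, ⟨h0, h1⟩, rfl⟩ := (PG2.mem_denniston4Classes hF).1 hT
    rw [← PG2.card_isoParams hF h0 h1, ← Set.ncard_coe_finset,
      ← Set.InjOn.ncard_image (f := PG2.conic (1 : F) 1)]
    · congr 1
      ext C
      simp only [Set.mem_image, Finset.mem_coe, PG2.mem_isoParams]
      constructor
      · rintro ⟨⟨c, hc0, rfl⟩, hc1, K, hK, hgen⟩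
        have hc1' : c ≠ 1 := by
          rintro rfl
          exact hc1 rfl
        rw [PG2.generates_iff hF hc0 hc1'] at hgen
        subst hgen
        exact ⟨c, ⟨⟨hc0, hc1'⟩, hK⟩, rfl⟩
      · rintro ⟨c, ⟨⟨hc0, hc1⟩, hK⟩, rfl⟩
        exact ⟨⟨c, hc0, rfl⟩, fun h => hc1 (PG2.conic_injective hF hc0 h), _, hK,
          (PG2.generates_iff hF hc0 hc1).2 rfl⟩
    · intro c hc d hd h
      exact PG2.conic_injective hF (PG2.mem_isoParams.1 hc).1.1 h
  · have h := PG2.card_eq_two_mul_card_image_arc hF (PG2.params F) fun b hb =>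
      ⟨PG2.mem_params.1 hb, PG2.mem_params.2 (PG2.one_add_mem_params (PG2.mem_params.1 hb))⟩
    have himg : PG2.denniston4ArcsInPencil (1 : F) = PG2.arc '' (PG2.params F : Set F) := by
      ext K
      simp only [PG2.mem_denniston4ArcsInPencil hF, Set.mem_image, Finset.mem_coe, PG2.mem_params]
    rw [himg]
    rw [PG2.card_params hF] at h
    omega
  · intro T hT
    obtain ⟨b, ⟨h0, h1⟩, rfl⟩ := (PG2.mem_denniston4Classes hF).1 hT
    have h := PG2.card_eq_two_mul_card_image_arc hF (PG2.isoParams b) fun c hc => by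
      have hc := PG2.mem_isoParams.1 hc
      exact ⟨hc.1, PG2.mem_isoParams.2
        ⟨PG2.one_add_mem_params hc.1, by rw [PG2.arc_one_add]; exact hc.2⟩⟩
    have himg : {K : Set (PG2.Point F) | K ∈ PG2.denniston4ArcsInPencil (1 : F) ∧
        K ∈ {K | PG2.Isomorphic (PG2.arc b) K}} = PG2.arc '' (PG2.isoParams b : Set F) := by
      ext K
      simp only [Set.mem_image, Finset.mem_coe, PG2.mem_isoParams]
      constructor
      · rintro ⟨hK, hiso⟩
        obtain ⟨c, hc, rfl⟩ := (PG2.mem_denniston4ArcsInPencil hF).1 hK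
        exact ⟨c, ⟨hc, hiso⟩, rfl⟩
      · rintro ⟨c, ⟨hc, hiso⟩, rfl⟩
        exact ⟨(PG2.mem_denniston4ArcsInPencil hF).2 ⟨c, hc, rfl⟩, hiso⟩
    rw [himg]
    rw [PG2.card_isoParams hF h0 h1] at h
    omega
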